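/- **Conventions.** All Hilbert spaces are complex, and $\mathbb D$, $\mathbb T$ are the open unit disk and the unit circle. For Hilbert spaces $X,Y$ the Schur class $\mathbf S(X,Y)$ is the set of holomorphic functions $\Theta:\mathbb D\to\mathbf L(X,Y)$ with $\|\Theta(z)\|\le 1$ for all $z$. For a contraction $T\in\mathbf L(X,Y)$ put $D_T=(I-T^*T)^{1/2}$, $\mathfrak D_T=\overline{\operatorname{ran}}\,D_T$, and let $$J_T=\begin{pmatrix}T&D_{T^*}\\ D_T&-T^*\end{pmatrix}:X\oplus\mathfrak D_{T^*}\to Y\oplus\mathfrak D_T ,$$ which is a unitary operator. *Schur parameters.* A function $Z\in\mathbf S(\mathfrak D_{\Theta(0)},\mathfrak D_{\Theta(0)^*})$ is the Möbius parameter of $\Theta\in\mathbf S(X,Y)$ if, for all $z\in\mathbb D$, the operator $I+\Theta(0)^*Z(z)$ on $\mathfrak D_{\Theta(0)}$ is boundedly invertible and $$\Theta(z)=\Theta(0)+D_{\Theta(0)^*}Z(z)\bigl(I+\Theta(0)^*Z(z)\bigr)^{-1}D_{\Theta(0)} .$$ The first Schur iterate of $\Theta$ is the function $\Theta_1\in\mathbf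 S(\mathfrak D_{\Theta(0)},\mathfrak D_{\Theta(0)^*})$ for which $z\mapsto z\,\Theta_1(z)$ is the Möbius parameter of $\Theta$. Starting with $\Theta_0=\Theta$ and letting $\Theta_{n+1}$ be the first Schur iterate of $\Theta_n$, one gets the Schur parameters $G_n=\Theta_n(0)$ of $\Theta$; thus $G_0\in\mathbf L(X,Y)$ and $G_{n+1}\in\mathbf L(\mathfrak D_{G_n},\mathfrak D_{G_n^*})$. *Block operator CMV matrices.* For the Schur parameters $\{G_n\}_{n\ge0}$ of a function in $\mathbf S(\mathfrak M,\mathfrak M)$ let $$\mathfrak H_0=\bigoplus_{n\ge0}\bigl(\mathfrak D_{G_{2n}}\oplus\mathfrak D_{G_{2n+1}^*}\bigr),\qquad \widetilde{\mathfrak H}_0=\bigoplus_{n\ge0}\bigl(\mathfrak D_{G_{2n}^*}\oplus\mathfrak D_{G_{2n+1}}\bigr),$$ let $M_0=I_{\mathfrak M}\oplus J_{G_1}\oplus J_{G_3}\oplus\cdots$ act from $\mathfrak M\oplus\mathfrak H_0$ to $\mathfrak M\oplus\widetilde{\mathfrak H}_0$, and let $L_0=J_{G_0}\oplus J_{G_2}\oplus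 J_{G_4}\oplus\cdots$ act from $\mathfrak M\oplus\widetilde{\mathfrak H}_0=(\mathfrak M\oplus\mathfrak D_{G_0^*})\oplus(\mathfrak D_{G_1}\oplus\mathfrak D_{G_2^*})\oplus\cdots$ to $\mathfrak M\oplus\mathfrak H_0=(\mathfrak M\oplus\mathfrak D_{G_0})\oplus(\mathfrak D_{G_1^*}\oplus\mathfrak D_{G_2})\oplus\cdots$. Put $$U_0=L_0M_0\ \text{ on } H_0=\mathfrak M\oplus\mathfrak H_0,\qquad \widetilde U_0=M_0L_0\ \text{ on } \widetilde H_0=\mathfrak M\oplus\widetilde{\mathfrak H}_0 .$$ (Defect spaces may be zero, and then the corresponding rows and columns are absent.) *Naimark dilations.* An $\mathbf L(\mathfrak M)$-valued Borel measure on $\mathbb T$ is a map $\mu$ from the Borel subsets of $\mathbb T$ to the nonnegative operators in $\mathbf L(\mathfrak M)$ with $\mu(\emptyset)=0$ which is $\sigma$-additive with respect to strong convergence; it is a probability measure if $\mu(\mathbb T)=I$. Its Fourier coefficients are $S_n=\int_{\mathbb T}\xi^{-n}\mu(d\xi)$, $n\in\mathbb Z$. A Naimark dilation of a probability measure $\mu$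 is a pair $\{H,U\}$ of a separable Hilbert space $H\supset\mathfrak M$ and a unitary operator $U$ in $H$ with $S_n=P_{\mathfrak M}U^n|\mathfrak M$ for all $n\in\mathbb Z$; it is minimal if $\overline{\operatorname{span}}\{U^n\mathfrak M:n\in\mathbb Z\}=H$. **Theorem.** Let $\mathfrak M$ be a separable Hilbert space and let $\mu$ be a probability $\mathbf L(\mathfrak M)$-valued Borel measure on $\mathbb T$. The integrals $S_n$, $n\in\mathbb Z$, and $$F(\lambda)=\int_{\mathbb T}\frac{\xi+\lambda}{\xi-\lambda}\,\mu(d\xi),\qquad\lambda\in\mathbb D,$$ exist as bounded operators, $F(\lambda)+I$ is boundedly invertible for $\lambda\in\mathbb D$, and the function $$E(\lambda)=\frac1\lambda\,(F(\lambda)-I)(F(\lambda)+I)^{-1}$$ (with its removable singularity at $\lambda=0$ removed) belongs to the Schur class $\mathbf S(\mathfrak M,\mathfrak M)$. All Schur iterates of $E$ exist and are uniquely determined on $\mathbb D$. Let $\{G_n\}_{n\ge0}$ be the Schur parameters of $E$ and let $U_0$, $\widetilde U_0$ be the block operator CMV matrices built from $\{G_n\}$. Then $\{H_0,U_0\}$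 and $\{\widetilde H_0,\widetilde U_0\}$ are minimal Naimark dilations of $\mu$, and they are unitarily equivalent: there is a unitary operator $W:H_0\to\widetilde H_0$ with $WU_0=\widetilde U_0W$ and $Wx=x$ for all $x\in\mathfrak M$. -/

import Mathlib

set_option linter.unusedSectionVars false

noncomputable section

namespace BlockCMV

open ContinuousLinearMap MeasureTheory
open scoped InnerProductSpace

/-! ### Defect operators and elementary rotations -/

section Defect

variable {X Y : Type*} [NormedAddCommGroup X] [InnerProductSpace ℂ X] [CompleteSpace X]
  [NormedAddCommGroup Y] [InnerProductSpace ℂ Y] [CompleteSpace Y]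

/-- The defect operator `D_T = (I - T* T)^{1/2}`; the operator `D_{T*}` is `defectOp (adjoint T)`. -/
def defectOp (T : X →L[ℂ] Y) : X →L[ℂ] X := CFC.sqrt (1 - adjoint T ∘L T)

/-- The defect subspace `𝔇_T`, the closure of the range of `D_T`. -/
def defectSpace (T : X →L[ℂ] Y) : Submodule ℂ X :=
  (LinearMap.range (defectOp T).toLinearMap).topologicalClosure

instance instCompleteSpaceDefectSpace (T : X →L[ℂ] Y) : CompleteSpace (defectSpace T) :=
  Submodule.topologicalClosure.completeSpace _

theorem defectOp_isPositive (T : X →L[ℂ] Y) : (defectOp T).IsPositive := by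
  rw [← nonneg_iff_isPositive]; exact CFC.sqrt_nonneg _

theorem one_sub_nonneg {T : X →L[ℂ] Y} (hT : ‖T‖ ≤ 1) : 0 ≤ 1 - adjoint T ∘L T := by
  rw [nonneg_iff_isPositive, isPositive_def]
  refine ⟨?_, fun x => ?_⟩
  · intro x y
    simp [inner_sub_left, inner_sub_right, adjoint_inner_left, adjoint_inner_right]
  · have h : ‖T x‖ ≤ ‖x‖ := by
      simpa using T.le_of_opNorm_le hT x
    simp [reApplyInnerSelf, inner_sub_left, adjoint_inner_left, inner_self_eq_norm_sq_to_K]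
    norm_cast
    gcongr

theorem defectOp_mul_self {T : X →L[ℂ] Y} (hT : ‖T‖ ≤ 1) (x : X) :
    defectOp T (defectOp T x) = x - adjoint T (T x) := by
  have h := CFC.sqrt_mul_sqrt_self (1 - adjoint T ∘L T) (one_sub_nonneg hT)
  simpa [defectOp] using! congrArg (fun A : X →L[ℂ] X => A x) h

/-- The block diagonal operator `diag(A, B)` (auxiliary). -/
def prodDiag (A : X →L[ℂ] X) (B : Y →L[ℂ] Y) : WithLp 2 (X × Y) →L[ℂ] WithLp 2 (X × Y) :=
  (WithLp.prodContinuousLinearEquiv 2 ℂ X Y).symm.toContinuousLinearMap ∘L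
    (A.prodMap B) ∘L (WithLp.prodContinuousLinearEquiv 2 ℂ X Y).toContinuousLinearMap

theorem prodDiag_nonneg {A : X →L[ℂ] X} {B : Y →L[ℂ] Y} (hA : A.IsPositive) (hB : B.IsPositive) :
    0 ≤ prodDiag A B := by
  rw [nonneg_iff_isPositive, isPositive_def]
  refine ⟨fun x y => ?_, fun x => ?_⟩
  · simp [prodDiag, hA.inner_left_eq_inner_right, hB.inner_left_eq_inner_right]
  · have h1 := hA.re_inner_nonneg_left x.fst
    have h2 := hB.re_inner_nonneg_left x.snd
    simp [prodDiag, reApplyInnerSelf] at *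
    linarith

theorem commute_of_sq {R S C : X →L[ℂ] X} (hR : 0 ≤ R) (hRS : R * R = S) (hc : Commute S C) :
    Commute R C := by
  have hsq : CFC.sqrt S = R := CFC.sqrt_unique hRS hR
  have hc' : Commute (CFC.sqrt S) C := hc.cfcₙ_nnreal NNReal.sqrt
  exact hsq ▸ hc'

theorem map_defectOp {T : X →L[ℂ] Y} (hT : ‖T‖ ≤ 1) (x : X) :
    T (defectOp T x) = defectOp (adjoint T) (T x) := by
  have hT' : ‖adjoint T‖ ≤ 1 := by simpa using hT
  let S : WithLp 2 (X × Y) →L[ℂ] WithLp 2 (X × Y) :=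
    prodDiag (1 - adjoint T ∘L T) (1 - adjoint (adjoint T) ∘L adjoint T)
  let R : WithLp 2 (X × Y) →L[ℂ] WithLp 2 (X × Y) := prodDiag (defectOp T) (defectOp (adjoint T))
  have hR : 0 ≤ R := prodDiag_nonneg (defectOp_isPositive _) (defectOp_isPositive _)
  have hRS : R * R = S := by
    refine ContinuousLinearMap.ext fun z => WithLp.ofLp_injective 2 (Prod.ext ?_ ?_)
    · simpa [R, S, prodDiag] using! defectOp_mul_self hT z.fst
    · simpa [R, S, prodDiag] using! defectOp_mul_self hT' z.snd
  let C : WithLp 2 (X × Y) →L[ℂ] WithLp 2 (X × Y) :=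
    (WithLp.prodContinuousLinearEquiv 2 ℂ X Y).symm.toContinuousLinearMap ∘L
      (ContinuousLinearMap.inr ℂ X Y ∘L T ∘L ContinuousLinearMap.fst ℂ X Y) ∘L
      (WithLp.prodContinuousLinearEquiv 2 ℂ X Y).toContinuousLinearMap
  have hc : Commute S C := by
    change S * C = C * S
    refine ContinuousLinearMap.ext fun z => WithLp.ofLp_injective 2 (Prod.ext ?_ ?_)
    · simp [S, C, prodDiag]
    · simp [S, C, prodDiag]
  have hc' : Commute R C := commute_of_sq hR hRS hc
  have h := congrArg (fun A : WithLp 2 (X × Y) →L[ℂ] WithLp 2 (X × Y) =>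
    (A (WithLp.toLp 2 (x, 0))).snd) hc'.eq
  simpa [R, prodDiag, C] using h.symm

theorem defectOp_mem (T : X →L[ℂ] Y) (x : X) : defectOp T x ∈ defectSpace T :=
  Submodule.le_topologicalClosure _ ⟨x, rfl⟩

theorem map_mem_defectSpace {T : X →L[ℂ] Y} (hT : ‖T‖ ≤ 1) {x : X} (hx : x ∈ defectSpace T) :
    T x ∈ defectSpace (adjoint T) := by
  have h : Set.MapsTo T (Set.range (defectOp T)) (Set.range (defectOp (adjoint T))) := by
    rintro _ ⟨y, rfl⟩
    exact ⟨T y, (map_defectOp hT y).symm⟩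
  exact h.closure T.continuous hx

/-- `D_T` as an operator from `X` to `𝔇_T`. -/
def defectMap (T : X →L[ℂ] Y) : X →L[ℂ] defectSpace T :=
  (defectOp T).codRestrict (defectSpace T) (defectOp_mem T)

/-- `D_T` restricted to `𝔇_T`, as an operator from `𝔇_T` to `X`. -/
def defectIncl (T : X →L[ℂ] Y) : defectSpace T →L[ℂ] X :=
  defectOp T ∘L (defectSpace T).subtypeL

/-- A contraction `T` restricted to an operator from `𝔇_T` to `𝔇_{T*}`. -/
def defectRestrict (T : X →L[ℂ] Y) (hT : ‖T‖ ≤ 1) :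
    defectSpace T →L[ℂ] defectSpace (adjoint T) :=
  (T ∘L (defectSpace T).subtypeL).codRestrict (defectSpace (adjoint T))
    fun x => map_mem_defectSpace hT x.2

theorem adjoint_mem_defectSpace {T : X →L[ℂ] Y} (hT : ‖T‖ ≤ 1) {y : Y}
    (hy : y ∈ defectSpace (adjoint T)) : adjoint T y ∈ defectSpace T := by
  have h := map_mem_defectSpace (T := adjoint T) (by simpa using hT) hy
  simpa using h

/-- `T*` restricted to an operator from `𝔇_{T*}` to `𝔇_T`. -/
def adjointRestrict (T : X →L[ℂ] Y) (hT : ‖T‖ ≤ 1) :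
    defectSpace (adjoint T) →L[ℂ] defectSpace T :=
  (adjoint T ∘L (defectSpace (adjoint T)).subtypeL).codRestrict (defectSpace T)
    fun y => adjoint_mem_defectSpace hT y.2

@[simp] theorem coe_defectMap (T : X →L[ℂ] Y) (x : X) : (defectMap T x : X) = defectOp T x := rfl

@[simp] theorem defectIncl_apply (T : X →L[ℂ] Y) (x : defectSpace T) :
    defectIncl T x = defectOp T x := rfl

@[simp] theorem coe_defectRestrict (T : X →L[ℂ] Y) (hT : ‖T‖ ≤ 1) (x : defectSpace T) :
    (defectRestrict T hT x : Y) = T x := rfl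

@[simp] theorem coe_adjointRestrict (T : X →L[ℂ] Y) (hT : ‖T‖ ≤ 1)
    (y : defectSpace (adjoint T)) : (adjointRestrict T hT y : X) = adjoint T y := rfl

theorem defectOp_symm (T : X →L[ℂ] Y) (x y : X) : ⟪defectOp T x, y⟫_ℂ = ⟪x, defectOp T y⟫_ℂ :=
  (defectOp_isPositive T).inner_left_eq_inner_right x y

theorem adjoint_defectOp {T : X →L[ℂ] Y} (hT : ‖T‖ ≤ 1) (y : Y) :
    adjoint T (defectOp (adjoint T) y) = defectOp T (adjoint T y) := by
  have h := map_defectOp (T := adjoint T) (by simpa using hT) y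
  simpa using h

theorem defectOp_adjoint_mul_self {T : X →L[ℂ] Y} (hT : ‖T‖ ≤ 1) (y : Y) :
    defectOp (adjoint T) (defectOp (adjoint T) y) = y - T (adjoint T y) := by
  have h := defectOp_mul_self (T := adjoint T) (by simpa using hT) y
  simpa using h

/-- The block operator matrix `[[T, D_{T*}], [D_T, -T*]] : X ⊕ 𝔇_{T*} → Y ⊕ 𝔇_T`. -/
def rotationLin (T : X →L[ℂ] Y) (hT : ‖T‖ ≤ 1) :
    WithLp 2 (X × defectSpace (adjoint T)) →ₗ[ℂ] WithLp 2 (Y × defectSpace T) where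
  toFun z := WithLp.toLp 2
    (T z.fst + defectIncl (adjoint T) z.snd, defectMap T z.fst - adjointRestrict T hT z.snd)
  map_add' z w := by
    apply WithLp.ofLp_injective 2
    ext <;> simp <;> abel
  map_smul' c z := by
    apply WithLp.ofLp_injective 2
    ext <;> simp [smul_sub]

/-- The block operator matrix `[[T*, D_T], [D_{T*}, -T]] : Y ⊕ 𝔇_T → X ⊕ 𝔇_{T*}`. -/
def rotationInvLin (T : X →L[ℂ] Y) (hT : ‖T‖ ≤ 1) :
    WithLp 2 (Y × defectSpace T) →ₗ[ℂ] WithLp 2 (X × defectSpace (adjoint T)) where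
  toFun z := WithLp.toLp 2
    (adjoint T z.fst + defectIncl T z.snd, defectMap (adjoint T) z.fst - defectRestrict T hT z.snd)
  map_add' z w := by
    apply WithLp.ofLp_injective 2
    ext <;> simp <;> abel
  map_smul' c z := by
    apply WithLp.ofLp_injective 2
    ext <;> simp [smul_sub]

theorem rotation_left_inv (T : X →L[ℂ] Y) (hT : ‖T‖ ≤ 1)
    (z : WithLp 2 (X × defectSpace (adjoint T))) :
    rotationInvLin T hT (rotationLin T hT z) = z := by
  apply WithLp.ofLp_injective 2
  refine Prod.ext ?_ (Subtype.ext ?_)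
  · simp [rotationLin, rotationInvLin, defectOp_mul_self hT, adjoint_defectOp hT]
  · simp [rotationLin, rotationInvLin, defectOp_adjoint_mul_self hT, map_defectOp hT]

theorem rotation_right_inv (T : X →L[ℂ] Y) (hT : ‖T‖ ≤ 1) (w : WithLp 2 (Y × defectSpace T)) :
    rotationLin T hT (rotationInvLin T hT w) = w := by
  apply WithLp.ofLp_injective 2
  refine Prod.ext ?_ (Subtype.ext ?_)
  · simp [rotationLin, rotationInvLin, defectOp_adjoint_mul_self hT, map_defectOp hT]
  · simp [rotationLin, rotationInvLin, defectOp_mul_self hT, adjoint_defectOp hT]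

theorem rotation_inner (T : X →L[ℂ] Y) (hT : ‖T‖ ≤ 1)
    (z : WithLp 2 (X × defectSpace (adjoint T))) (w : WithLp 2 (Y × defectSpace T)) :
    ⟪rotationLin T hT z, w⟫_ℂ = ⟪z, rotationInvLin T hT w⟫_ℂ := by
  simp [rotationLin, rotationInvLin, inner_add_left, inner_add_right, inner_sub_left, inner_sub_right, adjoint_inner_left,
    adjoint_inner_right, defectOp_symm]
  ring

/-- The elementary rotation `J_T = [[T, D_{T*}], [D_T, -T*]] : X ⊕ 𝔇_{T*} → Y ⊕ 𝔇_T` of a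
contraction `T`, a unitary operator. If `T` is isometric then `𝔇_T = 0` and `J_T` is the row
`[T, I]`; if `T` is co-isometric then `𝔇_{T*} = 0` and `J_T` is the column `[T; D_T]`. -/
def rotation (T : X →L[ℂ] Y) (hT : ‖T‖ ≤ 1) :
    WithLp 2 (X × defectSpace (adjoint T)) ≃ₗᵢ[ℂ] WithLp 2 (Y × defectSpace T) where
  toLinearEquiv := LinearEquiv.ofLinearMap (rotationLin T hT) (rotationInvLin T hT)
    (LinearMap.ext (rotation_right_inv T hT)) (LinearMap.ext (rotation_left_inv T hT))
  norm_map' z := by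
    have h : ⟪rotationLin T hT z, rotationLin T hT z⟫_ℂ = ⟪z, z⟫_ℂ := by
      rw [rotation_inner, rotation_left_inv]
    rw [inner_self_eq_norm_sq_to_K, inner_self_eq_norm_sq_to_K] at h
    have h' : ‖rotationLin T hT z‖ ^ 2 = ‖z‖ ^ 2 := by exact_mod_cast h
    exact (sq_eq_sq₀ (norm_nonneg _) (norm_nonneg _)).1 h'

end Defect

/-! ### Orthogonal sums -/

section Sums

theorem memlp_two_iff {E : ℕ → Type*} [∀ n, NormedAddCommGroup (E n)] (f : ∀ n, E n) :
    Memℓp f 2 ↔ Summable fun n => ‖f n‖ ^ 2 := by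
  rw [memℓp_gen_iff (by norm_num)]
  norm_num

theorem lp_norm_sq {E : ℕ → Type*} [∀ n, NormedAddCommGroup (E n)] (f : lp E 2) :
    ‖f‖ ^ 2 = ∑' n, ‖f n‖ ^ 2 := by
  have h := lp.norm_rpow_eq_tsum (p := 2) (by norm_num) f
  norm_num at h
  exact h

theorem lp_summable {E : ℕ → Type*} [∀ n, NormedAddCommGroup (E n)] (f : lp E 2) :
    Summable fun n => ‖f n‖ ^ 2 := (memlp_two_iff _).1 (lp.memℓp f)

/-- The block diagonal unitary operator `⊕ₙ eₙ` between orthogonal sums of Hilbert spaces. -/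
def blockDiag {E F : ℕ → Type*} [∀ n, NormedAddCommGroup (E n)] [∀ n, InnerProductSpace ℂ (E n)]
    [∀ n, NormedAddCommGroup (F n)] [∀ n, InnerProductSpace ℂ (F n)]
    (e : ∀ n, E n ≃ₗᵢ[ℂ] F n) : lp E 2 ≃ₗᵢ[ℂ] lp F 2 where
  toFun f := ⟨fun n => e n (f n), (memlp_two_iff _).2 (by simpa using lp_summable f)⟩
  invFun f := ⟨fun n => (e n).symm (f n), (memlp_two_iff _).2 (by simpa using lp_summable f)⟩
  map_add' f g := by ext n; exact map_add (e n) _ _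
  map_smul' c f := by ext n; simp
  left_inv f := by ext n; simp
  right_inv f := by ext n; simp
  norm_map' f := by
    refine (sq_eq_sq₀ (norm_nonneg _) (norm_nonneg _)).1 ?_
    rw [lp_norm_sq, lp_norm_sq]
    simp

variable {G : Type*} {A B : ℕ → Type*} [NormedAddCommGroup G] [InnerProductSpace ℂ G]
  [∀ n, NormedAddCommGroup (A n)] [∀ n, InnerProductSpace ℂ (A n)]
  [∀ n, NormedAddCommGroup (B n)] [∀ n, InnerProductSpace ℂ (B n)]

theorem regroup_summable (f : lp (fun n => WithLp 2 (A n × B n)) 2) :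
    (Summable fun n => ‖(f n).fst‖ ^ 2) ∧ Summable fun n => ‖(f n).snd‖ ^ 2 := by
  have h := lp_summable f
  simp only [WithLp.prod_norm_sq_eq_of_L2] at h
  exact ⟨h.of_nonneg_of_le (fun _ => by positivity) fun n => by
      have := sq_nonneg ‖(f n).snd‖; linarith,
    h.of_nonneg_of_le (fun _ => by positivity) fun n => by
      have := sq_nonneg ‖(f n).fst‖; linarith⟩

/-- The entries of a sequence starting with `a` and continuing with the second components. -/
def consSnd (a : A 0) (f : ∀ n, WithLp 2 (B n × A (n + 1))) : ∀ n, A n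
  | 0 => a
  | n + 1 => (f n).snd

theorem consSnd_summable (a : A 0) (f : lp (fun n => WithLp 2 (B n × A (n + 1))) 2) :
    Summable fun n => ‖consSnd a f n‖ ^ 2 :=
  (summable_nat_add_iff 1).1 (regroup_summable f).2

/-- The identification
`G ⊕ (A₀ ⊕ B₀) ⊕ (A₁ ⊕ B₁) ⊕ ⋯ = (G ⊕ A₀) ⊕ (B₀ ⊕ A₁) ⊕ (B₁ ⊕ A₂) ⊕ ⋯`, as a linear map. -/
def regroupLin (G : Type*) (A B : ℕ → Type*) [NormedAddCommGroup G] [InnerProductSpace ℂ G]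
    [∀ n, NormedAddCommGroup (A n)] [∀ n, InnerProductSpace ℂ (A n)]
    [∀ n, NormedAddCommGroup (B n)] [∀ n, InnerProductSpace ℂ (B n)] :
    WithLp 2 (G × lp (fun n => WithLp 2 (A n × B n)) 2) →ₗ[ℂ]
      WithLp 2 (WithLp 2 (G × A 0) × lp (fun n => WithLp 2 (B n × A (n + 1))) 2) where
  toFun z := WithLp.toLp 2 (WithLp.toLp 2 (z.fst, (z.snd 0).fst),
    ⟨fun n => WithLp.toLp 2 ((z.snd n).snd, (z.snd (n + 1)).fst), (memlp_two_iff _).2 (by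
      simp only [WithLp.prod_norm_sq_eq_of_L2]
      exact (regroup_summable z.snd).2.add
        ((summable_nat_add_iff 1).2 (regroup_summable z.snd).1))⟩)
  map_add' z w := rfl
  map_smul' c z := rfl

theorem norm_regroupLin (z : WithLp 2 (G × lp (fun n => WithLp 2 (A n × B n)) 2)) :
    ‖regroupLin G A B z‖ = ‖z‖ := by
  refine (sq_eq_sq₀ (norm_nonneg _) (norm_nonneg _)).1 ?_
  have h1 := (regroup_summable z.snd).1
  have h2 := (regroup_summable z.snd).2
  have h3 := (summable_nat_add_iff 1).2 h1
  have h4 := h1.tsum_eq_zero_add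
  have h5 : ‖regroupLin G A B z‖ ^ 2 = ‖z.fst‖ ^ 2 + ‖(z.snd 0).fst‖ ^ 2 +
      ∑' n, (‖(z.snd n).snd‖ ^ 2 + ‖(z.snd (n + 1)).fst‖ ^ 2) := by
    rw [WithLp.prod_norm_sq_eq_of_L2, WithLp.prod_norm_sq_eq_of_L2, lp_norm_sq]
    congr 1
    exact tsum_congr fun n => WithLp.prod_norm_sq_eq_of_L2 _
  have h6 : ‖z‖ ^ 2 = ‖z.fst‖ ^ 2 + ∑' n, (‖(z.snd n).fst‖ ^ 2 + ‖(z.snd n).snd‖ ^ 2) := by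
    rw [WithLp.prod_norm_sq_eq_of_L2, lp_norm_sq]
    congr 1
    exact tsum_congr fun n => WithLp.prod_norm_sq_eq_of_L2 _
  rw [h5, h6, h1.tsum_add h2, h2.tsum_add h3, h4]
  ring

theorem regroupLin_surjective : Function.Surjective (regroupLin G A B) := by
  intro w
  refine ⟨WithLp.toLp 2 (w.fst.fst,
    ⟨fun n => WithLp.toLp 2 (consSnd w.fst.snd w.snd n, (w.snd n).fst), (memlp_two_iff _).2 (by
      simp only [WithLp.prod_norm_sq_eq_of_L2]
      exact (consSnd_summable w.fst.snd w.snd).add (regroup_summable w.snd).1)⟩), ?_⟩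
  apply WithLp.ofLp_injective 2
  exact Prod.ext (WithLp.ofLp_injective 2 (Prod.ext rfl rfl))
    (lp.ext (funext fun n => WithLp.ofLp_injective 2 (Prod.ext rfl rfl)))

/-- The identification `regroupLin` as a unitary operator. -/
def regroup (G : Type*) (A B : ℕ → Type*) [NormedAddCommGroup G] [InnerProductSpace ℂ G]
    [∀ n, NormedAddCommGroup (A n)] [∀ n, InnerProductSpace ℂ (A n)]
    [∀ n, NormedAddCommGroup (B n)] [∀ n, InnerProductSpace ℂ (B n)] :
    WithLp 2 (G × lp (fun n => WithLp 2 (A n × B n)) 2) ≃ₗᵢ[ℂ]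
      WithLp 2 (WithLp 2 (G × A 0) × lp (fun n => WithLp 2 (B n × A (n + 1))) 2) :=
  LinearIsometryEquiv.ofSurjective ⟨regroupLin G A B, norm_regroupLin⟩ regroupLin_surjective

end Sums

/-! ### The Schur class and the Schur algorithm -/

section Schur

/-- The Schur class `S(X, Y)`: holomorphic contractive operator functions on the unit disk
(values outside the disk are irrelevant). -/
def IsSchurClass {X Y : Type*} [NormedAddCommGroup X] [InnerProductSpace ℂ X]
    [NormedAddCommGroup Y] [InnerProductSpace ℂ Y] (Θ : ℂ → X →L[ℂ] Y) : Prop :=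
  DifferentiableOn ℂ Θ (Metric.ball 0 1) ∧ ∀ z ∈ Metric.ball (0 : ℂ) 1, ‖Θ z‖ ≤ 1

theorem IsSchurClass.norm_zero_le {X Y : Type*} [NormedAddCommGroup X] [InnerProductSpace ℂ X]
    [NormedAddCommGroup Y] [InnerProductSpace ℂ Y] {Θ : ℂ → X →L[ℂ] Y} (h : IsSchurClass Θ) :
    ‖Θ 0‖ ≤ 1 := h.2 0 (by simp)

variable {X Y : Type*} [NormedAddCommGroup X] [InnerProductSpace ℂ X] [CompleteSpace X]
  [NormedAddCommGroup Y] [InnerProductSpace ℂ Y] [CompleteSpace Y]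

/-- `Z ∈ S(𝔇_{Θ(0)}, 𝔇_{Θ*(0)})` is the Möbius parameter of the Schur class function `Θ`:
`Θ(z) = Θ(0) + D_{Θ*(0)} Z(z) (I + Θ*(0) Z(z))⁻¹ D_{Θ(0)}` on the unit disk. -/
def IsMobiusParameter (Θ : ℂ → X →L[ℂ] Y) (hΘ : IsSchurClass Θ)
    (Z : ℂ → defectSpace (Θ 0) →L[ℂ] defectSpace (adjoint (Θ 0))) : Prop :=
  IsSchurClass Z ∧ ∀ z ∈ Metric.ball (0 : ℂ) 1,
    IsUnit (1 + adjointRestrict (Θ 0) hΘ.norm_zero_le ∘L Z z) ∧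
    Θ z = Θ 0 + defectIncl (adjoint (Θ 0)) ∘L Z z ∘L
      Ring.inverse (1 + adjointRestrict (Θ 0) hΘ.norm_zero_le ∘L Z z) ∘L defectMap (Θ 0)

/-- `Θ'` is the first Schur iterate of `Θ`: it belongs to the Schur class and `Θ'(z) = Z(z) / z`
for the Möbius parameter `Z` of `Θ`. -/
def IsSchurIterate (Θ : ℂ → X →L[ℂ] Y) (hΘ : IsSchurClass Θ)
    (Θ' : ℂ → defectSpace (Θ 0) →L[ℂ] defectSpace (adjoint (Θ 0))) : Prop :=
  IsSchurClass Θ' ∧ IsMobiusParameter Θ hΘ fun z => z • Θ' z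

end Schur

universe u

/-- A Schur class function together with its input space `X` and its output space `Y`. -/
structure SchurFunction where
  X : Type u
  Y : Type u
  [normedX : NormedAddCommGroup X]
  [innerX : InnerProductSpace ℂ X]
  [completeX : CompleteSpace X]
  [normedY : NormedAddCommGroup Y]
  [innerY : InnerProductSpace ℂ Y]
  [completeY : CompleteSpace Y]
  toFun : ℂ → X →L[ℂ] Y
  isSchur : IsSchurClass toFun

namespace SchurFunction

attribute [instance] normedX innerX completeX normedY innerY completeY

open Classical in
/-- The first Schur iterate of `S`. (The zero function is a placeholder for the case that
there is no Schur iterate, a case that does not occur.) -/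
def next (S : SchurFunction) : SchurFunction where
  X := defectSpace (S.toFun 0)
  Y := defectSpace (adjoint (S.toFun 0))
  toFun := if h : ∃ Θ', IsSchurIterate S.toFun S.isSchur Θ' then h.choose else 0
  isSchur := by
    split_ifs with h
    · exact h.choose_spec.1
    · exact ⟨differentiableOn_const 0, fun z _ => by simp⟩

/-- The `n`-th Schur iterate of `S`. -/
def iterate (S : SchurFunction) : ℕ → SchurFunction
  | 0 => S
  | n + 1 => (S.iterate n).next

/-- The `n`-th Schur parameter `Γₙ = Θₙ(0)` of `S`. As the input and output spaces of
`S.iterate (n + 1)` are `𝔇_{Γₙ}` and `𝔇_{Γₙ*}` by definition, `Γₙ₊₁ : 𝔇_{Γₙ} → 𝔇_{Γₙ*}`. -/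
def param (S : SchurFunction) (n : ℕ) : (S.iterate n).X →L[ℂ] (S.iterate n).Y :=
  (S.iterate n).toFun 0

theorem norm_param_le (S : SchurFunction) (n : ℕ) : ‖S.param n‖ ≤ 1 :=
  (S.iterate n).isSchur.norm_zero_le

/-- The defect space `𝔇_{Γₙ}`. -/
def D (S : SchurFunction.{u}) (n : ℕ) : Type u := defectSpace (S.param n)

/-- The defect space `𝔇_{Γₙ*}`. -/
def Dstar (S : SchurFunction.{u}) (n : ℕ) : Type u := defectSpace (adjoint (S.param n))

section Instances

variable (S : SchurFunction.{u}) (n : ℕ)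

instance instNormedD : NormedAddCommGroup (S.D n) :=
  inferInstanceAs (NormedAddCommGroup (defectSpace (S.param n)))

instance instInnerD : InnerProductSpace ℂ (S.D n) :=
  inferInstanceAs (InnerProductSpace ℂ (defectSpace (S.param n)))

instance instCompleteD : CompleteSpace (S.D n) :=
  inferInstanceAs (CompleteSpace (defectSpace (S.param n)))

instance instNormedDstar : NormedAddCommGroup (S.Dstar n) :=
  inferInstanceAs (NormedAddCommGroup (defectSpace (adjoint (S.param n))))

instance instInnerDstar : InnerProductSpace ℂ (S.Dstar n) :=
  inferInstanceAs (InnerProductSpace ℂ (defectSpace (adjoint (S.param n))))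

instance instCompleteDstar : CompleteSpace (S.Dstar n) :=
  inferInstanceAs (CompleteSpace (defectSpace (adjoint (S.param n))))

end Instances

/-- The elementary rotation `J_{Γ₀} : X ⊕ 𝔇_{Γ₀*} → Y ⊕ 𝔇_{Γ₀}`. -/
def rotZero (S : SchurFunction) :
    WithLp 2 (S.X × S.Dstar (2 * 0)) ≃ₗᵢ[ℂ] WithLp 2 (S.Y × S.D (2 * 0)) :=
  rotation (S.param 0) (S.norm_param_le 0)

/-- The elementary rotation `J_{Γₙ₊₁} : 𝔇_{Γₙ} ⊕ 𝔇_{Γₙ₊₁*} → 𝔇_{Γₙ*} ⊕ 𝔇_{Γₙ₊₁}`. -/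
def rotSucc (S : SchurFunction) (n : ℕ) :
    WithLp 2 (S.D n × S.Dstar (n + 1)) ≃ₗᵢ[ℂ] WithLp 2 (S.Dstar n × S.D (n + 1)) :=
  rotation (S.param (n + 1)) (S.norm_param_le (n + 1))

/-- The state space `H₀ = ⊕ₙ (𝔇_{Γ₂ₙ} ⊕ 𝔇_{Γ₂ₙ₊₁*})`. -/
abbrev H₀ (S : SchurFunction) := lp (fun n : ℕ => WithLp 2 (S.D (2 * n) × S.Dstar (2 * n + 1))) 2

/-- The state space `H̃₀ = ⊕ₙ (𝔇_{Γ₂ₙ*} ⊕ 𝔇_{Γ₂ₙ₊₁})`. -/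
abbrev Ht₀ (S : SchurFunction) := lp (fun n : ℕ => WithLp 2 (S.Dstar (2 * n) × S.D (2 * n + 1))) 2

/-- `V₀ = J_{Γ₁} ⊕ J_{Γ₃} ⊕ ⋯ : H₀ → H̃₀`. -/
def V₀ (S : SchurFunction) : S.H₀ ≃ₗᵢ[ℂ] S.Ht₀ := blockDiag fun n => S.rotSucc (2 * n)

/-- `M₀ = I ⊕ J_{Γ₁} ⊕ J_{Γ₃} ⊕ ⋯ : X ⊕ H₀ → X ⊕ H̃₀`. -/
def M₀ (S : SchurFunction) : WithLp 2 (S.X × S.H₀) ≃ₗᵢ[ℂ] WithLp 2 (S.X × S.Ht₀) :=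
  LinearIsometryEquiv.withLpProdCongr 2 (LinearIsometryEquiv.refl ℂ S.X) S.V₀

/-- `M̃₀ = I ⊕ J_{Γ₁} ⊕ J_{Γ₃} ⊕ ⋯ : Y ⊕ H₀ → Y ⊕ H̃₀`. -/
def Mt₀ (S : SchurFunction) : WithLp 2 (S.Y × S.H₀) ≃ₗᵢ[ℂ] WithLp 2 (S.Y × S.Ht₀) :=
  LinearIsometryEquiv.withLpProdCongr 2 (LinearIsometryEquiv.refl ℂ S.Y) S.V₀

/-- The elementary rotation
`J_{Γ₂ₙ₊₂} : 𝔇_{Γ₂ₙ₊₁} ⊕ 𝔇_{Γ₂ₙ₊₂*} → 𝔇_{Γ₂ₙ₊₁*} ⊕ 𝔇_{Γ₂ₙ₊₂}`. -/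
def rotEven (S : SchurFunction) (n : ℕ) :
    WithLp 2 (S.D (2 * n + 1) × S.Dstar (2 * (n + 1))) ≃ₗᵢ[ℂ]
      WithLp 2 (S.Dstar (2 * n + 1) × S.D (2 * (n + 1))) :=
  S.rotSucc (2 * n + 1)

/-- `J_{Γ₀} ⊕ J_{Γ₂} ⊕ J_{Γ₄} ⊕ ⋯`, from `(X ⊕ 𝔇_{Γ₀*}) ⊕ (𝔇_{Γ₁} ⊕ 𝔇_{Γ₂*}) ⊕ ⋯` to
`(Y ⊕ 𝔇_{Γ₀}) ⊕ (𝔇_{Γ₁*} ⊕ 𝔇_{Γ₂}) ⊕ ⋯`. -/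
def evenDiag (S : SchurFunction) :
    WithLp 2 (WithLp 2 (S.X × S.Dstar (2 * 0)) ×
      lp (fun n : ℕ => WithLp 2 (S.D (2 * n + 1) × S.Dstar (2 * (n + 1)))) 2) ≃ₗᵢ[ℂ]
    WithLp 2 (WithLp 2 (S.Y × S.D (2 * 0)) ×
      lp (fun n : ℕ => WithLp 2 (S.Dstar (2 * n + 1) × S.D (2 * (n + 1)))) 2) :=
  LinearIsometryEquiv.withLpProdCongr 2 S.rotZero (blockDiag S.rotEven)

/-- `L₀ = J_{Γ₀} ⊕ J_{Γ₂} ⊕ J_{Γ₄} ⊕ ⋯ : X ⊕ H̃₀ → Y ⊕ H₀`, where `X ⊕ H̃₀` and `Y ⊕ H₀` are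
regrouped as `(X ⊕ 𝔇_{Γ₀*}) ⊕ (𝔇_{Γ₁} ⊕ 𝔇_{Γ₂*}) ⊕ ⋯` and
`(Y ⊕ 𝔇_{Γ₀}) ⊕ (𝔇_{Γ₁*} ⊕ 𝔇_{Γ₂}) ⊕ ⋯`. -/
def L₀ (S : SchurFunction) : WithLp 2 (S.X × S.Ht₀) ≃ₗᵢ[ℂ] WithLp 2 (S.Y × S.H₀) :=
  (regroup S.X (fun n => S.Dstar (2 * n)) (fun n => S.D (2 * n + 1))).trans
    (S.evenDiag.trans
      (regroup S.Y (fun n => S.D (2 * n)) (fun n => S.Dstar (2 * n + 1))).symm)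

/-- The block operator CMV matrix `U₀ = L₀ M₀ : X ⊕ H₀ → Y ⊕ H₀`. -/
def U₀ (S : SchurFunction) : WithLp 2 (S.X × S.H₀) ≃ₗᵢ[ℂ] WithLp 2 (S.Y × S.H₀) :=
  S.M₀.trans S.L₀

/-- The block operator CMV matrix `Ũ₀ = M̃₀ L₀ : X ⊕ H̃₀ → Y ⊕ H̃₀`. -/
def Ut₀ (S : SchurFunction) : WithLp 2 (S.X × S.Ht₀) ≃ₗᵢ[ℂ] WithLp 2 (S.Y × S.Ht₀) :=
  S.L₀.trans S.Mt₀

end SchurFunction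

/-- The block operator CMV matrix `U₀` on `𝔐 ⊕ H₀` built from the Schur parameters of a function
`Θ` of the Schur class `S(𝔐, 𝔐)`. -/
abbrev cmv {𝔐 : Type*} [NormedAddCommGroup 𝔐] [InnerProductSpace ℂ 𝔐] [CompleteSpace 𝔐]
    (Θ : ℂ → 𝔐 →L[ℂ] 𝔐) (hΘ : IsSchurClass Θ) :
    WithLp 2 (𝔐 × (SchurFunction.mk 𝔐 𝔐 Θ hΘ).H₀) ≃ₗᵢ[ℂ]
      WithLp 2 (𝔐 × (SchurFunction.mk 𝔐 𝔐 Θ hΘ).H₀) :=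
  (SchurFunction.mk 𝔐 𝔐 Θ hΘ).U₀

/-- The block operator CMV matrix `Ũ₀` on `𝔐 ⊕ H̃₀` built from the Schur parameters of a function
`Θ` of the Schur class `S(𝔐, 𝔐)`. -/
abbrev cmvt {𝔐 : Type*} [NormedAddCommGroup 𝔐] [InnerProductSpace ℂ 𝔐] [CompleteSpace 𝔐]
    (Θ : ℂ → 𝔐 →L[ℂ] 𝔐) (hΘ : IsSchurClass Θ) :
    WithLp 2 (𝔐 × (SchurFunction.mk 𝔐 𝔐 Θ hΘ).Ht₀) ≃ₗᵢ[ℂ]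
      WithLp 2 (𝔐 × (SchurFunction.mk 𝔐 𝔐 Θ hΘ).Ht₀) :=
  (SchurFunction.mk 𝔐 𝔐 Θ hΘ).Ut₀

/-! ### Operator measures on the unit circle -/

/-- The unit circle. -/
abbrev 𝕋 : Type := Metric.sphere (0 : ℂ) 1

/-- An `L(𝔐)`-valued Borel measure on the unit circle: nonnegative and `σ`-additive with respect
to strong convergence (values on non-measurable sets are irrelevant). -/
structure OperatorMeasure (𝔐 : Type*) [NormedAddCommGroup 𝔐] [InnerProductSpace ℂ 𝔐] where
  toFun : Set 𝕋 → 𝔐 →L[ℂ] 𝔐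
  nonneg : ∀ s, MeasurableSet s → (toFun s).IsPositive
  empty : toFun ∅ = 0
  hasSum_iUnion : ∀ s : ℕ → Set 𝕋, (∀ i, MeasurableSet (s i)) →
    Pairwise (Function.onFun Disjoint s) →
    ∀ x, HasSum (fun i => toFun (s i) x) (toFun (⋃ i, s i) x)

namespace OperatorMeasure

variable {𝔐 : Type*} [NormedAddCommGroup 𝔐] [InnerProductSpace ℂ 𝔐]

/-- The positive scalar measure `δ ↦ (μ(δ) x, x)`. -/
def quad (μ : OperatorMeasure 𝔐) (x : 𝔐) : Measure 𝕋 :=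
  Measure.ofMeasurable (fun s _ => ENNReal.ofReal (RCLike.re ⟪x, μ.toFun s x⟫_ℂ))
    (by simp [μ.empty])
    (fun s hs hd => by
      have h := (μ.hasSum_iUnion s hs hd x).mapL (innerSL ℂ x)
      have h' := h.mapL Complex.reCLM
      simp only [innerSL_apply_apply, Complex.reCLM_apply] at h'
      change ENNReal.ofReal (⟪x, μ.toFun (⋃ i, s i) x⟫_ℂ).re = _
      rw [← h'.tsum_eq, ENNReal.ofReal_tsum_of_nonneg _ h'.summable]
      · rfl
      · intro n
        exact (μ.nonneg _ (hs n)).re_inner_nonneg_right x)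

/-- `A = ∫ f dμ` in the weak sense: `(A x, x) = ∫ f(ξ) (μ(dξ) x, x)` for all `x`.
(On a complex Hilbert space the quadratic form determines `A`.) -/
def HasIntegral (μ : OperatorMeasure 𝔐) (f : 𝕋 → ℂ) (A : 𝔐 →L[ℂ] 𝔐) : Prop :=
  ∀ x, Integrable f (μ.quad x) ∧ ⟪x, A x⟫_ℂ = ∫ ξ, f ξ ∂(μ.quad x)

open Classical in
/-- The operator `∫ f dμ` (zero if there is no such operator). -/
def integral (μ : OperatorMeasure 𝔐) (f : 𝕋 → ℂ) : 𝔐 →L[ℂ] 𝔐 :=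
  if h : ∃ A, μ.HasIntegral f A then h.choose else 0

/-- The Fourier coefficient `Sₙ = ∫ ξ⁻ⁿ μ(dξ)`. -/
def fourierCoeff (μ : OperatorMeasure 𝔐) (n : ℤ) : 𝔐 →L[ℂ] 𝔐 :=
  μ.integral fun ξ => (ξ : ℂ) ^ (-n)

/-- The function `F(z) = ∫ (ξ + z) / (ξ - z) μ(dξ)`. -/
def caratheodory (μ : OperatorMeasure 𝔐) (z : ℂ) : 𝔐 →L[ℂ] 𝔐 :=
  μ.integral fun ξ => ((ξ : ℂ) + z) / ((ξ : ℂ) - z)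

/-- The function `E(z) = z⁻¹ (F(z) - I) (F(z) + I)⁻¹`, with the value at the removable
singularity `0` equal to the derivative of `(F - I) (F + I)⁻¹` at `0`. -/
def schurFun (μ : OperatorMeasure 𝔐) (z : ℂ) : 𝔐 →L[ℂ] 𝔐 :=
  if z = 0 then
    deriv (fun w => (μ.caratheodory w - 1) * Ring.inverse (μ.caratheodory w + 1)) 0
  else z⁻¹ • ((μ.caratheodory z - 1) * Ring.inverse (μ.caratheodory z + 1))

end OperatorMeasure

/-! ### Naimark dilations -/

section Naimark

variable {𝔐 H : Type*} [NormedAddCommGroup 𝔐] [InnerProductSpace ℂ 𝔐] [CompleteSpace 𝔐]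
  [NormedAddCommGroup H] [InnerProductSpace ℂ H] [CompleteSpace H]

/-- `{H, U}` is a Naimark dilation of `μ`, where `𝔐` is a subspace of `H` through the isometric
embedding `ι`, so that the orthogonal projection `P_𝔐` is the adjoint of `ι`. -/
structure IsNaimarkDilation (μ : OperatorMeasure 𝔐) (ι : 𝔐 →ₗᵢ[ℂ] H) (U : H ≃ₗᵢ[ℂ] H) :
    Prop where
  separable : TopologicalSpace.SeparableSpace H
  fourierCoeff_eq : ∀ (n : ℤ) (x : 𝔐),
    μ.fourierCoeff n x = adjoint ι.toContinuousLinearMap ((U ^ n) (ι x))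

/-- `H` is the closed linear span of the subspaces `Uⁿ 𝔐`, `n ∈ ℤ`. -/
def IsMinimalDilation (ι : 𝔐 →ₗᵢ[ℂ] H) (U : H ≃ₗᵢ[ℂ] H) : Prop :=
  (Submodule.span ℂ {h : H | ∃ (n : ℤ) (x : 𝔐), h = (U ^ n) (ι x)}).topologicalClosure = ⊤

end Naimark

/-- The embedding `x ↦ (x, 0)` of `𝔐` into `𝔐 ⊕ K`. -/
def inclLeft (𝔐 K : Type*) [NormedAddCommGroup 𝔐] [InnerProductSpace ℂ 𝔐]
    [NormedAddCommGroup K] [InnerProductSpace ℂ K] : 𝔐 →ₗᵢ[ℂ] WithLp 2 (𝔐 × K) where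
  toFun x := WithLp.toLp 2 (x, 0)
  map_add' x y := by
    apply WithLp.ofLp_injective 2
    simp
  map_smul' c x := by
    apply WithLp.ofLp_injective 2
    simp
  norm_map' x := WithLp.norm_toLp_fst 2 𝔐 K x

end BlockCMV

end

set_option linter.unusedSectionVars false

noncomputable section

/-! The matrix `U₀` is a unitary colligation whose transfer function is `E`: for `|z| < 1` and `x ∈
𝔐` there is a state `k` with `U₀ (x, z k) = (E(z) x, k)` (`exists_U₀_eq`). Then `v = (x, z k)`
satisfies `v - z U₀ v = (x - z E(z) x, 0)`, so the compression of `(I - z U₀)⁻¹` to `𝔐` is `(I - z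
E(z))⁻¹`. Since `z E(z)` is the Cayley transform of `F`, this inverse equals `(F(z) + I) / 2 = ∑ zⁿ
Sₙ`. Comparing power series coefficients gives `Sₙ = P U₀ⁿ` on `𝔐` for `n ≥ 0`, and adjoints give `n
< 0` (`fourierCoeff_eq_compression`).

The state `k` comes from the Schur algorithm. Each iterate obeys `J_{Γₙ} (x, z Θₙ₊₁(z) w) = (Θₙ(z)
x, w)` for some `w` (`IsSchurIterate.exists_rotation_eq`). Chaining these relations through the even
and odd rotations produces the components of `k`. The rotations preserve norms, so an energy
difference telescopes and makes `k` square summable.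

The iterates exist (`exists_isSchurIterate`) because the operator Schwarz–Pick inequality
`schwarzPick` supplies exactly the estimates that Douglas' lemma needs to factor out the Möbius
parameter `Z`, with `‖Z(z)‖ ≤ |z|`. Since `Z` is found point by point, its holomorphy is derived
from that of `Θ` through matrix elements on dense sets and local boundedness.

For minimality, let `K` be a closed subspace that contains `𝔐` and is invariant under `U₀` and its
inverse, and compare `K` with `M₀ K`. The corner entries `D_T` and `D_{T*}` of a rotation have dense
range in their defect spaces, so each rotation forces the next pair of blocks into these subspaces,
and by induction `K` is everything (`SchurFunction.blockVec_mem`).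

Finally, `M₀ (L₀ M₀) = (M₀ L₀) M₀` and `M₀` fixes `𝔐`. Thus `W = M₀` is the required equivalence and
carries every property of `U₀` over to `Ũ₀`. -/

namespace BlockCMV

open ContinuousLinearMap MeasureTheory
open scoped InnerProductSpace

/-! ### Operators and their quadratic forms. -/

section QuadraticForms

variable {E : Type*} [NormedAddCommGroup E] [InnerProductSpace ℂ E]

theorem ext_inner_right_self {A B : E →L[ℂ] E} (h : ∀ x, ⟪x, A x⟫_ℂ = ⟪x, B x⟫_ℂ) : A = B := by
  have h' := (ext_inner_map A.toLinearMap B.toLinearMap).1 fun x => by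
    have := congrArg (starRingEnd ℂ) (h x)
    simpa using this
  exact ContinuousLinearMap.ext fun x => LinearMap.congr_fun h' x

/-- Weak integrals control only the quadratic form. For unit vectors, polarization expresses `⟪A y,
x⟫` by four quadratic values; by the parallelogram law these add up to at most `8 c`, and division
by `4` leaves the factor `2`. -/
theorem opNorm_le_of_inner_self_le {A : E →L[ℂ] E} {c : ℝ} (hc : 0 ≤ c)
    (h : ∀ x, ‖⟪x, A x⟫_ℂ‖ ≤ c * ‖x‖ ^ 2) : ‖A‖ ≤ 2 * c := by
  refine opNorm_le_of_re_inner_le (by positivity) fun y x hy hx => ?_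
  refine (RCLike.re_le_norm _).trans ?_
  have h' : ∀ u : E, ‖⟪A.toLinearMap u, u⟫_ℂ‖ ≤ c * ‖u‖ ^ 2 := fun u => by
    rw [← inner_conj_symm, RCLike.norm_conj]; exact h u
  have hpol := inner_map_polarization A.toLinearMap x y
  have p1 := parallelogram_law_with_norm ℂ x y
  have p2 := parallelogram_law_with_norm ℂ x (Complex.I • y)
  have hIy : ‖Complex.I • y‖ = 1 := by simp [norm_smul, hy]
  have h1 := h' (x + y)
  have h2 := h' (x - y)
  have h3 := h' (x + Complex.I • y)
  have h4 := h' (x - Complex.I • y)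
  rw [hIy] at p2
  rw [hx] at p1 p2
  rw [hy] at p1
  change ‖⟪A.toLinearMap y, x⟫_ℂ‖ ≤ _
  rw [hpol, norm_div, div_le_iff₀ (by simp)]
  set a := ⟪A.toLinearMap (x + y), x + y⟫_ℂ
  set b := ⟪A.toLinearMap (x - y), x - y⟫_ℂ
  set d := ⟪A.toLinearMap (x + Complex.I • y), x + Complex.I • y⟫_ℂ
  set e := ⟪A.toLinearMap (x - Complex.I • y), x - Complex.I • y⟫_ℂ
  have t1 : ‖a - b + Complex.I * d - Complex.I * e‖ ≤ ‖a‖ + ‖b‖ + ‖d‖ + ‖e‖ := by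
    refine (norm_sub_le _ _).trans ?_
    refine (add_le_add_left ((norm_add_le _ _).trans (add_le_add_left (norm_sub_le _ _) _)) _).trans ?_
    simp
  have h4' : ‖(4 : ℂ)‖ = 4 := by simp
  rw [h4']
  nlinarith

end QuadraticForms

/-! ### Weak integration against an operator measure. -/

namespace OperatorMeasure

variable {𝔐 : Type*} [NormedAddCommGroup 𝔐] [InnerProductSpace ℂ 𝔐] (μ : OperatorMeasure 𝔐)

theorem quad_apply (x : 𝔐) {s : Set 𝕋} (hs : MeasurableSet s) :
    μ.quad x s = ENNReal.ofReal (RCLike.re ⟪x, μ.toFun s x⟫_ℂ) :=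
  Measure.ofMeasurable_apply s hs

instance isFiniteMeasure_quad (x : 𝔐) : IsFiniteMeasure (μ.quad x) :=
  ⟨by rw [μ.quad_apply x MeasurableSet.univ]; exact ENNReal.ofReal_lt_top⟩

theorem quad_real_univ (hμ : μ.toFun Set.univ = 1) (x : 𝔐) :
    (μ.quad x).real Set.univ = ‖x‖ ^ 2 := by
  rw [measureReal_def, μ.quad_apply x MeasurableSet.univ, hμ]
  rw [ENNReal.toReal_ofReal]
  · simp [inner_self_eq_norm_sq_to_K]; norm_cast
  · simp [inner_self_eq_norm_sq_to_K]; norm_cast; positivity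

variable {μ}

theorem HasIntegral.unique {f : 𝕋 → ℂ} {A B : 𝔐 →L[ℂ] 𝔐} (hA : μ.HasIntegral f A)
    (hB : μ.HasIntegral f B) : A = B :=
  ext_inner_right_self fun x => (hA x).2.trans (hB x).2.symm

theorem HasIntegral.integral_eq {f : 𝕋 → ℂ} {A : 𝔐 →L[ℂ] 𝔐} (hA : μ.HasIntegral f A) :
    μ.integral f = A := by
  have h : ∃ A, μ.HasIntegral f A := ⟨A, hA⟩
  rw [integral, dif_pos h]
  exact h.choose_spec.unique hA

theorem HasIntegral.add {f g : 𝕋 → ℂ} {A B : 𝔐 →L[ℂ] 𝔐} (hA : μ.HasIntegral f A)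
    (hB : μ.HasIntegral g B) : μ.HasIntegral (f + g) (A + B) := fun x =>
  ⟨(hA x).1.add (hB x).1, by
    rw [add_apply, inner_add_right, (hA x).2, (hB x).2, ← integral_add (hA x).1 (hB x).1]; rfl⟩

theorem HasIntegral.const_mul {f : 𝕋 → ℂ} {A : 𝔐 →L[ℂ] 𝔐} (hA : μ.HasIntegral f A) (c : ℂ) :
    μ.HasIntegral (fun ξ => c * f ξ) (c • A) := fun x =>
  ⟨(hA x).1.const_mul c, by
    rw [smul_apply, inner_smul_right, (hA x).2, integral_const_mul]⟩

theorem HasIntegral.sub {f g : 𝕋 → ℂ} {A B : 𝔐 →L[ℂ] 𝔐} (hA : μ.HasIntegral f A)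
    (hB : μ.HasIntegral g B) : μ.HasIntegral (f - g) (A - B) := fun x =>
  ⟨(hA x).1.sub (hB x).1, by
    rw [sub_apply, inner_sub_right, (hA x).2, (hB x).2, ← integral_sub (hA x).1 (hB x).1]; rfl⟩

theorem hasIntegral_indicator (c : ℂ) {s : Set 𝕋} (hs : MeasurableSet s) :
    μ.HasIntegral (s.indicator fun _ => c) (c • μ.toFun s) := fun x => by
  refine ⟨(integrable_const c).indicator hs, ?_⟩
  have h := (μ.nonneg s hs).re_inner_nonneg_right x
  -- Positivity makes the form real, so no information is lost when the scalar measure keeps only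
  -- its real part.
  have him : ⟪x, μ.toFun s x⟫_ℂ = ((RCLike.re ⟪x, μ.toFun s x⟫_ℂ : ℝ) : ℂ) := by
    have := (μ.nonneg s hs).isSymmetric.coe_re_inner_self_apply x
    exact this.symm
  rw [integral_indicator_const c hs, measureReal_def, μ.quad_apply x hs, ENNReal.toReal_ofReal h,
    smul_apply, inner_smul_right, him]
  simp [mul_comm]

theorem hasIntegral_one (hμ : μ.toFun Set.univ = 1) : μ.HasIntegral (fun _ => 1) 1 := by
  simpa [hμ] using hasIntegral_indicator (μ := μ) 1 MeasurableSet.univ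

theorem exists_hasIntegral_simpleFunc (f : SimpleFunc 𝕋 ℂ) : ∃ A, μ.HasIntegral f A := by
  induction f using SimpleFunc.induction with
  | @const c s hs =>
    refine ⟨c • μ.toFun s, ?_⟩
    rw [SimpleFunc.coe_piecewise]
    convert hasIntegral_indicator (μ := μ) c hs using 1
    ext ξ
    simp [Set.piecewise, Set.indicator]
  | add _ hA hB =>
    obtain ⟨A, hA⟩ := hA
    obtain ⟨B, hB⟩ := hB
    exact ⟨A + B, hA.add hB⟩

theorem HasIntegral.norm_inner_le (hμ : μ.toFun Set.univ = 1) {f : 𝕋 → ℂ} {A : 𝔐 →L[ℂ] 𝔐}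
    (hA : μ.HasIntegral f A) {c : ℝ} (hf : ∀ ξ, ‖f ξ‖ ≤ c) (x : 𝔐) :
    ‖⟪x, A x⟫_ℂ‖ ≤ c * ‖x‖ ^ 2 := by
  rw [(hA x).2]
  have := norm_integral_le_of_norm_le_const (μ := μ.quad x) (Filter.Eventually.of_forall hf)
  rwa [μ.quad_real_univ hμ] at this

theorem HasIntegral.norm_le (hμ : μ.toFun Set.univ = 1) {f : 𝕋 → ℂ} {A : 𝔐 →L[ℂ] 𝔐}
    (hA : μ.HasIntegral f A) {c : ℝ} (hc : 0 ≤ c) (hf : ∀ ξ, ‖f ξ‖ ≤ c) : ‖A‖ ≤ 2 * c :=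
  opNorm_le_of_inner_self_le hc (hA.norm_inner_le hμ hf)

/-- The circle is compact, so the range of `f` has a finite `ε`-net; rounding `f` to a nearest point
of the net gives the simple function. -/
theorem exists_simpleFunc_norm_sub_le {f : 𝕋 → ℂ} (hf : Continuous f) {ε : ℝ} (hε : 0 < ε) :
    ∃ g : SimpleFunc 𝕋 ℂ, ∀ ξ, ‖g ξ - f ξ‖ ≤ ε := by
  obtain ⟨t, ht, hcov⟩ := Metric.totallyBounded_iff.1 (isCompact_range hf).totallyBounded ε hε
  have hne : t.Nonempty := by
    obtain ⟨y, hy, -⟩ := Set.mem_iUnion₂.1 (hcov ⟨(⟨1, by simp⟩ : 𝕋), rfl⟩)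
    exact ⟨y, hy⟩
  obtain ⟨e, he⟩ := ht.countable.exists_eq_range hne
  -- `nearestPt e N` looks only at `e 0, …, e N`, so `N` must be large enough for these terms to
  -- exhaust the net.
  have hN : ∃ N, ∀ y ∈ t, ∃ k ≤ N, e k = y := by
    have : ∀ y ∈ t, ∃ k, e k = y := fun y hy => by rw [he] at hy; exact hy
    choose! k hk using this
    obtain ⟨N, hN⟩ := (ht.image k).bddAbove
    exact ⟨N, fun y hy => ⟨k y, hN ⟨y, hy, rfl⟩, hk y hy⟩⟩
  obtain ⟨N, hN⟩ := hN
  refine ⟨(SimpleFunc.nearestPt e N).comp f hf.measurable, fun ξ => ?_⟩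
  obtain ⟨y, hy, hd⟩ := Set.mem_iUnion₂.1 (hcov ⟨ξ, rfl⟩)
  obtain ⟨k, hk, rfl⟩ := hN y hy
  have h := SimpleFunc.edist_nearestPt_le e (f ξ) hk
  rw [edist_dist, edist_dist, ENNReal.ofReal_le_ofReal_iff dist_nonneg] at h
  rw [← dist_eq_norm]
  refine h.trans ?_
  rw [dist_comm]
  exact (Metric.mem_ball.1 hd).le

variable [CompleteSpace 𝔐]

/-- Integrals of uniform approximations by simple functions form a Cauchy sequence in operator norm,
by the factor `2` estimate for quadratic forms. Its limit has the right quadratic form because each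
scalar measure has mass `‖x‖²`. -/
theorem exists_hasIntegral (hμ : μ.toFun Set.univ = 1) {f : 𝕋 → ℂ} (hf : Continuous f) :
    ∃ A, μ.HasIntegral f A := by
  choose g hg using fun n : ℕ => exists_simpleFunc_norm_sub_le hf (Nat.one_div_pos_of_nat (n := n))
  choose A hA using fun n => exists_hasIntegral_simpleFunc (μ := μ) (g n)
  have hlim := tendsto_one_div_add_atTop_nhds_zero_nat (𝕜 := ℝ)
  have hC : CauchySeq A := by
    refine cauchySeq_of_le_tendsto_0 (fun N => 2 * (1 / ((N : ℝ) + 1) + 1 / ((N : ℝ) + 1)))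
      (fun n m N hn hm => ?_) (by simpa using (hlim.add hlim).const_mul 2)
    rw [dist_eq_norm]
    refine ((hA n).sub (hA m)).norm_le hμ (by positivity) fun ξ => ?_
    have e : (⇑(g n) - ⇑(g m)) ξ = (g n ξ - f ξ) - (g m ξ - f ξ) := by simp
    rw [e]
    refine (norm_sub_le _ _).trans (add_le_add ((hg n ξ).trans ?_) ((hg m ξ).trans ?_))
    · exact Nat.one_div_le_one_div hn
    · exact Nat.one_div_le_one_div hm
  obtain ⟨B, hB⟩ := cauchySeq_tendsto_of_complete hC
  obtain ⟨C, hfC⟩ := (isCompact_range hf).isBounded.exists_norm_le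
  refine ⟨B, fun x => ?_⟩
  have hfi : Integrable f (μ.quad x) :=
    .of_bound hf.aestronglyMeasurable C (Filter.Eventually.of_forall fun ξ => hfC _ ⟨ξ, rfl⟩)
  refine ⟨hfi, ?_⟩
  have h1 : Filter.Tendsto (fun n => ⟪x, A n x⟫_ℂ) Filter.atTop (nhds ⟪x, B x⟫_ℂ) :=
    tendsto_const_nhds.inner ((ContinuousLinearMap.apply ℂ 𝔐 x).continuous.tendsto B |>.comp hB)
  refine tendsto_nhds_unique h1 ?_
  rw [tendsto_iff_norm_sub_tendsto_zero]
  refine squeeze_zero (fun _ => norm_nonneg _) (g := fun n : ℕ => 1 / ((n : ℝ) + 1) * ‖x‖ ^ 2)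
    (fun n => ?_) (by simpa using hlim.mul_const (‖x‖ ^ 2))
  rw [(hA n x).2, ← integral_sub (hA n x).1 hfi, ← μ.quad_real_univ hμ]
  exact norm_integral_le_of_norm_le_const (Filter.Eventually.of_forall (hg n))

theorem hasIntegral_integral (hμ : μ.toFun Set.univ = 1) {f : 𝕋 → ℂ} (hf : Continuous f) :
    μ.HasIntegral f (μ.integral f) := by
  obtain ⟨A, hA⟩ := exists_hasIntegral hμ hf
  rwa [hA.integral_eq]

/-! ### Fourier coefficients, the Carathéodory function and its Cayley transform. -/

theorem circle_ne_zero (ξ : 𝕋) : (ξ : ℂ) ≠ 0 := fun h => by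
  have := mem_sphere_zero_iff_norm.1 ξ.2
  simp [h] at this

theorem circle_sub_ne_zero (ξ : 𝕋) {z : ℂ} (hz : z ∈ Metric.ball (0 : ℂ) 1) :
    (ξ : ℂ) - z ≠ 0 := fun h => by
  have h1 := mem_sphere_zero_iff_norm.1 ξ.2
  have h2 := mem_ball_zero_iff.1 hz
  rw [sub_eq_zero.1 h] at h1
  linarith

theorem hasIntegral_fourierCoeff (hμ : μ.toFun Set.univ = 1) (n : ℤ) :
    μ.HasIntegral (fun ξ => (ξ : ℂ) ^ (-n)) (μ.fourierCoeff n) :=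
  hasIntegral_integral hμ (continuous_subtype_val.zpow₀ _ fun ξ => Or.inl (circle_ne_zero ξ))

theorem hasIntegral_caratheodory (hμ : μ.toFun Set.univ = 1) {z : ℂ}
    (hz : z ∈ Metric.ball (0 : ℂ) 1) :
    μ.HasIntegral (fun ξ => ((ξ : ℂ) + z) / ((ξ : ℂ) - z)) (μ.caratheodory z) :=
  hasIntegral_integral hμ ((continuous_subtype_val.add continuous_const).div
    (continuous_subtype_val.sub continuous_const) fun ξ => circle_sub_ne_zero ξ hz)

theorem caratheodory_zero (hμ : μ.toFun Set.univ = 1) : μ.caratheodory 0 = 1 := by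
  refine (hasIntegral_caratheodory hμ (by simp)).unique ?_
  convert hasIntegral_one hμ using 1
  ext ξ
  simp [circle_ne_zero ξ]

theorem norm_fourierCoeff_le (hμ : μ.toFun Set.univ = 1) (n : ℤ) : ‖μ.fourierCoeff n‖ ≤ 2 := by
  have := (hasIntegral_fourierCoeff hμ n).norm_le hμ zero_le_one fun ξ => by
    simp [mem_sphere_zero_iff_norm.1 ξ.2]
  simpa using this

theorem fourierCoeff_neg (hμ : μ.toFun Set.univ = 1) (n : ℤ) :
    μ.fourierCoeff (-n) = adjoint (μ.fourierCoeff n) := by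
  refine ext_inner_right_self fun x => ?_
  rw [adjoint_inner_right, ← inner_conj_symm (μ.fourierCoeff n x) x, (hasIntegral_fourierCoeff hμ _ x).2,
    (hasIntegral_fourierCoeff hμ _ x).2, ← integral_conj]
  congr 1
  ext ξ
  have h : (starRingEnd ℂ) (ξ : ℂ) = (ξ : ℂ)⁻¹ := by
    rw [Complex.inv_def, Complex.normSq_eq_norm_sq, mem_sphere_zero_iff_norm.1 ξ.2]
    simp
  change (ξ : ℂ) ^ (-(-n)) = (starRingEnd ℂ) ((ξ : ℂ) ^ (-n))
  rw [map_zpow₀, h, inv_zpow']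

theorem norm_pow_smul_fourierCoeff_le (hμ : μ.toFun Set.univ = 1) (z : ℂ) (n : ℕ) :
    ‖z ^ n • μ.fourierCoeff n‖ ≤ 2 * ‖z‖ ^ n := by
  rw [norm_smul, norm_pow, mul_comm]
  gcongr
  exact norm_fourierCoeff_le hμ n

/-- On the circle the geometric series gives `∑ zⁿ ξ⁻ⁿ = ξ / (ξ - z)`, which is half of `(ξ + z) /
(ξ - z) + 1`; it may be integrated term by term. -/
theorem hasSum_fourierCoeff (hμ : μ.toFun Set.univ = 1) {z : ℂ} (hz : z ∈ Metric.ball (0 : ℂ) 1) :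
    HasSum (fun n : ℕ => z ^ n • μ.fourierCoeff n) ((2 : ℂ)⁻¹ • (μ.caratheodory z + 1)) := by
  have hz1 : ‖z‖ < 1 := mem_ball_zero_iff.1 hz
  have hs : Summable fun n : ℕ => z ^ n • μ.fourierCoeff n :=
    Summable.of_norm_bounded ((summable_geometric_of_lt_one (norm_nonneg z) hz1).mul_left 2)
      (norm_pow_smul_fourierCoeff_le hμ z)
  convert hs.hasSum using 1
  refine ext_inner_right_self fun x => ?_
  have h1 := ((hasIntegral_caratheodory hμ hz).add (hasIntegral_one hμ)).const_mul (2 : ℂ)⁻¹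
  rw [(h1 x).2]
  have h2 : HasSum (fun n : ℕ => ⟪x, (z ^ n • μ.fourierCoeff n) x⟫_ℂ)
      ⟪x, (∑' n : ℕ, z ^ n • μ.fourierCoeff n) x⟫_ℂ :=
    (hs.hasSum.mapL (ContinuousLinearMap.apply ℂ 𝔐 x)).mapL (innerSL ℂ x)
  refine HasSum.unique ?_ h2
  have hI : ∀ n : ℕ, Integrable (fun ξ : 𝕋 => z ^ n * (ξ : ℂ) ^ (-(n : ℤ))) (μ.quad x) := fun n =>
    ((hasIntegral_fourierCoeff hμ n x).1).const_mul _
  have hnorm : ∀ (n : ℕ) (ξ : 𝕋), ‖z ^ n * (ξ : ℂ) ^ (-(n : ℤ))‖ = ‖z‖ ^ n := fun n ξ => by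
    simp [mem_sphere_zero_iff_norm.1 ξ.2]
  have h3 := hasSum_integral_of_summable_integral_norm hI (by
    simp only [hnorm, integral_const, smul_eq_mul]
    exact (summable_geometric_of_lt_one (norm_nonneg z) hz1).mul_left _)
  have e1 : (fun n : ℕ => ⟪x, (z ^ n • μ.fourierCoeff n) x⟫_ℂ) =
      fun n : ℕ => ∫ ξ : 𝕋, z ^ n * (ξ : ℂ) ^ (-(n : ℤ)) ∂μ.quad x := by
    ext n
    rw [smul_apply, inner_smul_right, (hasIntegral_fourierCoeff hμ n x).2, integral_const_mul]
  rw [e1]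
  have e2 : (fun ξ : 𝕋 => ∑' n : ℕ, z ^ n * (ξ : ℂ) ^ (-(n : ℤ))) =
      fun ξ : 𝕋 => (2 : ℂ)⁻¹ * (((ξ : ℂ) + z) / ((ξ : ℂ) - z) + 1) := by
    ext1 ξ
    have e : (fun n : ℕ => z ^ n * (ξ : ℂ) ^ (-(n : ℤ))) = fun n => (z / ξ) ^ n := by
      ext n; rw [zpow_neg, zpow_natCast, div_pow, div_eq_mul_inv]
    rw [e, tsum_geometric_of_norm_lt_one (by
      rw [norm_div, mem_sphere_zero_iff_norm.1 ξ.2, div_one]; exact hz1)]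
    have h0 := circle_ne_zero ξ
    have h0' := circle_sub_ne_zero ξ hz
    rw [one_sub_div h0]
    field_simp
    ring
  rw [e2] at h3
  exact h3

theorem differentiableOn_caratheodory (hμ : μ.toFun Set.univ = 1) :
    DifferentiableOn ℂ μ.caratheodory (Metric.ball 0 1) := by
  have key : DifferentiableOn ℂ (fun z : ℂ => ∑' n : ℕ, z ^ n • μ.fourierCoeff n)
      (Metric.ball 0 1) := by
    intro z hz
    obtain ⟨r, hr0, hr1⟩ := exists_between (mem_ball_zero_iff.1 hz)
    have hr : 0 < r := (norm_nonneg z).trans_lt hr0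
    have := Complex.differentiableOn_tsum_of_summable_norm (U := Metric.ball (0 : ℂ) r)
      (F := fun (n : ℕ) (z : ℂ) => z ^ n • μ.fourierCoeff n)
      ((summable_geometric_of_lt_one hr.le hr1).mul_left 2)
      (fun n => by fun_prop) Metric.isOpen_ball (fun n w hw =>
        (norm_pow_smul_fourierCoeff_le hμ w n).trans (by
          gcongr; exact (mem_ball_zero_iff.1 hw).le))
    exact (this.differentiableAt (Metric.isOpen_ball.mem_nhds
      (mem_ball_zero_iff.2 hr0))).differentiableWithinAt
  refine ((key.const_smul (2 : ℂ)).sub (differentiableOn_const 1)).congr fun z hz => ?_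
  rw [Pi.sub_apply, Pi.smul_apply, (hasSum_fourierCoeff hμ hz).tsum_eq, smul_smul]
  simp

/-- The real part of the kernel is the Poisson kernel `(1 - |z|²) / |ξ - z|²`. -/
theorem re_inner_caratheodory_nonneg (hμ : μ.toFun Set.univ = 1) {z : ℂ}
    (hz : z ∈ Metric.ball (0 : ℂ) 1) (x : 𝔐) : 0 ≤ RCLike.re ⟪x, μ.caratheodory z x⟫_ℂ := by
  have h := hasIntegral_caratheodory hμ hz x
  rw [h.2, ← integral_re h.1]
  refine integral_nonneg fun ξ => ?_
  have h1 := mem_sphere_zero_iff_norm.1 ξ.2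
  have h2 := mem_ball_zero_iff.1 hz
  change 0 ≤ (((ξ : ℂ) + z) / ((ξ : ℂ) - z)).re
  rw [Complex.div_re, ← add_div]
  refine div_nonneg ?_ (Complex.normSq_nonneg _)
  have h3 : (ξ : ℂ).re ^ 2 + (ξ : ℂ).im ^ 2 = 1 := by
    have := Complex.sq_norm (ξ : ℂ)
    rw [h1, Complex.normSq_apply] at this
    linarith
  have h4 : z.re ^ 2 + z.im ^ 2 ≤ 1 := by
    have := Complex.sq_norm z
    rw [Complex.normSq_apply] at this
    nlinarith [norm_nonneg z]
  simp only [Complex.add_re, Complex.sub_re, Complex.add_im, Complex.sub_im]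
  nlinarith

theorem isUnit_caratheodory_add_one (hμ : μ.toFun Set.univ = 1) {z : ℂ}
    (hz : z ∈ Metric.ball (0 : ℂ) 1) : IsUnit (μ.caratheodory z + 1) := by
  refine isUnit_of_forall_le_norm_inner_map _ (c := 1) one_pos fun x => ?_
  rw [← inner_conj_symm, RCLike.norm_conj]
  refine le_trans ?_ (RCLike.re_le_norm _)
  have h := re_inner_caratheodory_nonneg hμ hz x
  simp only [add_apply, one_apply_eq_self, inner_add_right, map_add, inner_self_eq_norm_sq]
  simpa using h

/-- The Cayley transform `(F(z) - I) (F(z) + I)⁻¹`. -/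
def cayley (μ : OperatorMeasure 𝔐) (z : ℂ) : 𝔐 →L[ℂ] 𝔐 :=
  (μ.caratheodory z - 1) * Ring.inverse (μ.caratheodory z + 1)

/-- With `E` written as a divided difference of the Cayley transform, holomorphy at `0` and the
Schwarz lemma apply directly. -/
theorem schurFun_eq_dslope (hμ : μ.toFun Set.univ = 1) : μ.schurFun = dslope μ.cayley 0 := by
  ext1 z
  rcases eq_or_ne z 0 with rfl | hz
  · rw [schurFun, if_pos rfl, dslope_same]; rfl
  · rw [schurFun, if_neg hz, dslope_of_ne _ hz, slope_def_module]
    simp [cayley, caratheodory_zero hμ]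

/-- Substituting `y = (F + I) x` reduces the bound to `‖(F + I) x‖² - ‖(F - I) x‖² = 4 Re ⟪F x, x⟫ ≥
0`. -/
theorem norm_cayley_le (hμ : μ.toFun Set.univ = 1) {z : ℂ} (hz : z ∈ Metric.ball (0 : ℂ) 1) :
    ‖μ.cayley z‖ ≤ 1 := by
  refine opNorm_le_bound _ zero_le_one fun y => ?_
  have hu := isUnit_caratheodory_add_one hμ hz
  set x := Ring.inverse (μ.caratheodory z + 1) y with hx
  have hy : y = (μ.caratheodory z + 1) x := by
    change y = ((μ.caratheodory z + 1) * Ring.inverse (μ.caratheodory z + 1)) y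
    rw [Ring.mul_inverse_cancel _ hu]; rfl
  have e : μ.cayley z y = (μ.caratheodory z - 1) x := rfl
  rw [e, one_mul]
  conv_rhs => rw [hy]
  refine (sq_le_sq₀ (norm_nonneg _) (norm_nonneg _)).1 ?_
  simp only [sub_apply, add_apply, one_apply_eq_self]
  rw [norm_sub_sq (𝕜 := ℂ), norm_add_sq (𝕜 := ℂ)]
  have h := re_inner_caratheodory_nonneg hμ hz x
  rw [← inner_conj_symm, RCLike.conj_re] at h
  linarith

theorem cayley_zero (hμ : μ.toFun Set.univ = 1) : μ.cayley 0 = 0 := by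
  simp [cayley, caratheodory_zero hμ]

theorem differentiableOn_cayley (hμ : μ.toFun Set.univ = 1) :
    DifferentiableOn ℂ μ.cayley (Metric.ball 0 1) := by
  have h := differentiableOn_caratheodory hμ
  refine (h.sub (differentiableOn_const 1)).mul fun z hz => ?_
  obtain ⟨u, hu⟩ := isUnit_caratheodory_add_one hμ hz
  have h1 := (h.add (differentiableOn_const 1)) z hz
  have h2 := (differentiableAt_inverse (𝕜 := ℂ) u.isUnit)
  rw [hu] at h2
  exact h2.comp_differentiableWithinAt z h1

theorem isSchurClass_schurFun (hμ : μ.toFun Set.univ = 1) : IsSchurClass μ.schurFun := by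
  rw [schurFun_eq_dslope hμ]
  refine ⟨(Complex.differentiableOn_dslope (Metric.ball_mem_nhds 0 one_pos)).2
    (differentiableOn_cayley hμ), fun z hz => ?_⟩
  have := Complex.norm_dslope_le_div_of_mapsTo_ball (R₂ := 1) (differentiableOn_cayley hμ)
    (fun w hw => by rw [cayley_zero hμ]; simpa using norm_cayley_le hμ hw) hz
  simpa using this

/-- This links the measure to the colligation: `(F + I) / 2` generates the Fourier coefficients, and
`(I - z E)⁻¹` will be the compressed resolvent of `U₀`. -/
theorem caratheodory_mul_schurFun (hμ : μ.toFun Set.univ = 1) {z : ℂ}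
    (hz : z ∈ Metric.ball (0 : ℂ) 1) :
    ((2 : ℂ)⁻¹ • (μ.caratheodory z + 1)) * (1 - z • μ.schurFun z) = 1 := by
  have h1 : z • μ.schurFun z = μ.cayley z := by
    have := sub_smul_dslope μ.cayley 0 z
    rw [cayley_zero hμ, sub_zero, sub_zero] at this
    rw [schurFun_eq_dslope hμ, this]
  have hu := isUnit_caratheodory_add_one hμ hz
  have h2 : (1 - μ.cayley z) = (2 : ℂ) • Ring.inverse (μ.caratheodory z + 1) := by
    have h3 := Ring.mul_inverse_cancel _ hu
    rw [cayley]
    nth_rw 1 [← h3]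
    rw [← sub_mul, two_smul, ← two_mul]
    congr 1
    rw [add_sub_sub_cancel]
    exact one_add_one_eq_two
  rw [h1, h2, smul_mul_smul_comm, Ring.mul_inverse_cancel _ hu]
  simp

end OperatorMeasure

/-! ### From holomorphic matrix elements to holomorphy in norm. -/

section WeakHolomorphy

variable {E F : Type*} [NormedAddCommGroup E] [InnerProductSpace ℂ E]
  [NormedAddCommGroup F] [InnerProductSpace ℂ F]

theorem circleIntegral_comp_clm {G G' : Type*} [NormedAddCommGroup G] [NormedSpace ℂ G]
    [CompleteSpace G] [NormedAddCommGroup G'] [NormedSpace ℂ G'] [CompleteSpace G']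
    (L : G →L[ℂ] G') {f : ℂ → G} {c : ℂ} {R : ℝ} (hf : CircleIntegrable f c R) :
    L (∮ z in C(c, R), f z) = ∮ z in C(c, R), L (f z) := by
  rw [circleIntegral, circleIntegral, ← L.intervalIntegral_comp_comm hf.out]
  simp

/-- If the matrix elements of an operator function between elements of dense sets are holomorphic
on a disk where the function is bounded, then all its matrix elements are. -/
theorem differentiableOn_inner_of_dense {Q : ℂ → E →L[ℂ] F} {U : Set ℂ} (hU : IsOpen U) {M : ℝ}
    (hM : ∀ z ∈ U, ‖Q z‖ ≤ M) {s : Set E} {t : Set F} (hs : Dense s) (ht : Dense t)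
    (h : ∀ x ∈ s, ∀ y ∈ t, DifferentiableOn ℂ (fun z => ⟪y, Q z x⟫_ℂ) U) (x : E) (y : F) :
    DifferentiableOn ℂ (fun z => ⟪y, Q z x⟫_ℂ) U := by
  obtain ⟨u, hu, hux⟩ := mem_closure_iff_seq_limit.1 (hs x)
  obtain ⟨v, hv, hvy⟩ := mem_closure_iff_seq_limit.1 (ht y)
  have hlim : Filter.Tendsto (fun n => ‖v n‖ * (M * ‖u n - x‖) + ‖v n - y‖ * (M * ‖x‖))
      Filter.atTop (nhds 0) := by
    have h1 := (tendsto_iff_norm_sub_tendsto_zero.1 hux).const_mul M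
    have h2 := (tendsto_iff_norm_sub_tendsto_zero.1 hvy).mul_const (M * ‖x‖)
    simpa using (hvy.norm.mul h1).add h2
  refine TendstoLocallyUniformlyOn.differentiableOn
    (F := fun (n : ℕ) (z : ℂ) => ⟪v n, Q z (u n)⟫_ℂ) (φ := Filter.atTop)
    (TendstoUniformlyOn.tendstoLocallyUniformlyOn ?_)
    (.of_forall fun n => h _ (hu n) _ (hv n)) hU
  rw [Metric.tendstoUniformlyOn_iff]
  intro ε hε
  filter_upwards [hlim.eventually (gt_mem_nhds hε)] with n hn z hz
  refine lt_of_le_of_lt ?_ hn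
  have e : ⟪v n, Q z (u n)⟫_ℂ - ⟪y, Q z x⟫_ℂ = ⟪v n, Q z (u n - x)⟫_ℂ + ⟪v n - y, Q z x⟫_ℂ := by
    rw [map_sub, inner_sub_right, inner_sub_left]; ring
  rw [dist_comm, dist_eq_norm, e]
  refine (norm_add_le _ _).trans (add_le_add ((norm_inner_le_norm _ _).trans ?_)
    ((norm_inner_le_norm _ _).trans ?_))
  · gcongr; exact (Q z).le_of_opNorm_le (hM z hz) _
  · gcongr; exact (Q z).le_of_opNorm_le (hM z hz) _

/-- A bounded operator function with holomorphic matrix elements is continuous in norm. -/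
theorem norm_sub_le_of_differentiableOn_inner {Q : ℂ → E →L[ℂ] F} {c : ℂ} {R M : ℝ} (hR : 0 < R)
    (hM : ∀ z ∈ Metric.ball c R, ‖Q z‖ ≤ M)
    (h : ∀ x y, DifferentiableOn ℂ (fun z => ⟪y, Q z x⟫_ℂ) (Metric.ball c R)) {w : ℂ}
    (hw : w ∈ Metric.ball c R) : ‖Q w - Q c‖ ≤ 2 * M / R * dist w c := by
  have hM0 : 0 ≤ M := (norm_nonneg _).trans (hM _ hw)
  refine opNorm_le_of_re_inner_le (by positivity) fun x y hx hy => ?_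
  refine (RCLike.re_le_norm _).trans ?_
  rw [← inner_conj_symm, RCLike.norm_conj]
  have hb : ∀ z ∈ Metric.ball c R, ‖⟪y, Q z x⟫_ℂ‖ ≤ M := fun z hz => by
    refine (norm_inner_le_norm _ _).trans ?_
    have := (Q z).le_of_opNorm_le (hM z hz) x
    rw [hy, one_mul]
    simpa [hx] using this
  -- The scalar Schwarz lemma applies to each matrix element, whose oscillation is at most `2 M`;
  -- the bound is uniform over unit vectors and hence passes to the norm.
  have := Complex.dist_le_div_mul_dist_of_mapsTo_ball (R₂ := 2 * M) (h x y) (fun z hz => by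
    rw [Metric.mem_closedBall, dist_eq_norm]
    refine (norm_sub_le _ _).trans ?_
    have h1 := hb z hz
    have h2 := hb c (Metric.mem_ball_self hR)
    linarith) hw
  rw [dist_eq_norm] at this
  rwa [sub_apply, inner_sub_right]

variable [CompleteSpace F]

/-- Boundedness makes `Q` norm continuous, so its Cauchy integral exists in operator norm and is
analytic. The scalar Cauchy formula for each matrix element shows that this integral is `Q` itself.
-/
theorem differentiableAt_of_differentiableOn_inner {Q : ℂ → E →L[ℂ] F} {c : ℂ} {R M : ℝ}
    (hR : 0 < R) (hM : ∀ z ∈ Metric.ball c R, ‖Q z‖ ≤ M)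
    (h : ∀ x y, DifferentiableOn ℂ (fun z => ⟪y, Q z x⟫_ℂ) (Metric.ball c R)) :
    DifferentiableAt ℂ Q c := by
  have hsub : ∀ z ∈ Metric.ball c (R / 2), Metric.ball z (R / 2) ⊆ Metric.ball c R := fun z hz =>
    Metric.ball_subset_ball' (by have := Metric.mem_ball.1 hz; linarith)
  have hcont : ∀ z ∈ Metric.ball c (R / 2), ContinuousAt Q z := fun z hz => by
    have hR2 : 0 < R / 2 := by positivity
    have hlip := fun w (hw : w ∈ Metric.ball z (R / 2)) =>
      norm_sub_le_of_differentiableOn_inner hR2 (fun u hu => hM u (hsub z hz hu))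
        (fun x y => (h x y).mono (hsub z hz)) hw
    rw [ContinuousAt, tendsto_iff_norm_sub_tendsto_zero]
    refine squeeze_zero' (.of_forall fun _ => norm_nonneg _)
      (Filter.eventually_of_mem (Metric.ball_mem_nhds z hR2) hlip) ?_
    have : Filter.Tendsto (fun w => 2 * M / (R / 2) * dist w z) (nhds z)
        (nhds (2 * M / (R / 2) * dist z z)) :=
      ((continuous_id.dist continuous_const).const_mul _).tendsto z
    simpa using this
  -- Continuity is known only on the disk of radius `R / 2`, so the contour must lie inside it.
  obtain ⟨r, hr0, hr⟩ := exists_between (half_pos hR)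
  have hcb : Metric.closedBall c r ⊆ Metric.ball c (R / 2) := Metric.closedBall_subset_ball hr
  lift r to NNReal using hr0.le
  have hcQ : ContinuousOn Q (Metric.closedBall c r) := fun z hz =>
    (hcont z (hcb hz)).continuousWithinAt
  have hci : CircleIntegrable Q c r :=
    (hcQ.mono Metric.sphere_subset_closedBall).circleIntegrable r.2
  have hps := hasFPowerSeriesOn_cauchy_integral hci (by exact_mod_cast hr0)
  refine hps.analyticAt.differentiableAt.congr_of_eventuallyEq ?_
  filter_upwards [Metric.ball_mem_nhds c hr0] with w hw
  refine ContinuousLinearMap.ext fun x => ext_inner_left ℂ fun y => ?_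
  have hcw : ContinuousOn (fun z => (z - w)⁻¹ • Q z) (Metric.sphere c r) := by
    refine ContinuousOn.smul (ContinuousOn.inv₀
      (continuousOn_id.sub continuousOn_const) fun z hz h0 => ?_)
      (hcQ.mono Metric.sphere_subset_closedBall)
    rw [show z = w from sub_eq_zero.1 h0, Metric.mem_sphere] at hz
    exact (Metric.mem_ball.1 hw).ne hz
  let L : (E →L[ℂ] F) →L[ℂ] ℂ := innerSL ℂ y ∘L ContinuousLinearMap.apply ℂ F x
  have hL : ∀ A, L A = ⟪y, A x⟫_ℂ := fun A => rfl
  have hcomm := circleIntegral_comp_clm L (hcw.circleIntegrable r.2)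
  rw [← hL, ← hL, map_smul]
  refine Eq.trans ?_ (congrArg ((2 * Real.pi * Complex.I : ℂ)⁻¹ • ·) hcomm.symm)
  have hd : DifferentiableOn ℂ (fun z => L (Q z)) (Metric.ball c R) := h x y
  have hcR : Metric.closedBall c r ⊆ Metric.ball c R := Metric.closedBall_subset_ball (by linarith)
  have := (hd.mono hcR).diffContOnCl_ball subset_rfl |>.two_pi_i_inv_smul_circleIntegral_sub_inv_smul hw
  simp only [map_smul]
  exact this.symm

/-- A locally bounded operator function whose matrix elements between elements of dense sets are
holomorphic is holomorphic in norm. -/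
theorem differentiableOn_of_inner_dense {Q : ℂ → E →L[ℂ] F} {U : Set ℂ} (hU : IsOpen U)
    (hM : ∀ z ∈ U, ∃ M, ∀ᶠ w in nhds z, ‖Q w‖ ≤ M) {s : Set E} {t : Set F} (hs : Dense s)
    (ht : Dense t) (h : ∀ x ∈ s, ∀ y ∈ t, DifferentiableOn ℂ (fun z => ⟪y, Q z x⟫_ℂ) U) :
    DifferentiableOn ℂ Q U := by
  intro c hc
  obtain ⟨M, hM⟩ := hM c hc
  obtain ⟨R, hR, hball⟩ := Metric.mem_nhds_iff.1 (Filter.inter_mem (hU.mem_nhds hc) hM)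
  refine (differentiableAt_of_differentiableOn_inner hR (fun z hz => (hball hz).2) fun x y =>
    ?_).differentiableWithinAt
  exact differentiableOn_inner_of_dense Metric.isOpen_ball (fun z hz => (hball hz).2) hs ht
    (fun x hx y hy => (h x hx y hy).mono fun z hz => (hball hz).1) x y

end WeakHolomorphy

theorem differentiableOn_ringInverse {R : Type*} [NormedRing R] [NormedAlgebra ℂ R]
    [CompleteSpace R] {f : ℂ → R} {s : Set ℂ} (hf : DifferentiableOn ℂ f s)
    (hu : ∀ z ∈ s, IsUnit (f z)) : DifferentiableOn ℂ (fun z => Ring.inverse (f z)) s :=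
  fun z hz => (differentiableAt_inverse (𝕜 := ℂ) (hu z hz)).comp_differentiableWithinAt z (hf z hz)

/-! ### Inverses and Douglas factorization. -/

section Inverse

variable {E : Type*} [NormedAddCommGroup E] [InnerProductSpace ℂ E] {A : E →L[ℂ] E}

theorem ringInverse_apply_apply (hA : IsUnit A) (x : E) : Ring.inverse A (A x) = x :=
  congrArg (fun B : E →L[ℂ] E => B x) (Ring.inverse_mul_cancel A hA)

theorem apply_ringInverse_apply (hA : IsUnit A) (x : E) : A (Ring.inverse A x) = x :=
  congrArg (fun B : E →L[ℂ] E => B x) (Ring.mul_inverse_cancel A hA)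

theorem isUnit_one_sub_of_norm_lt [CompleteSpace E] (hA : ‖A‖ < 1) : IsUnit (1 - A) :=
  ⟨Units.oneSub A hA, rfl⟩

theorem isUnit_one_add_of_norm_lt [CompleteSpace E] (hA : ‖A‖ < 1) : IsUnit (1 + A) := by
  have := isUnit_one_sub_of_norm_lt (A := -A) (by rwa [norm_neg])
  rwa [sub_neg_eq_add] at this

/-- Douglas' lemma. -/
theorem exists_comp_eq_of_norm_le {P F G : Type*} [NormedAddCommGroup P] [NormedSpace ℂ P]
    [NormedAddCommGroup F] [InnerProductSpace ℂ F] [CompleteSpace F]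
    [NormedAddCommGroup G] [NormedSpace ℂ G] [CompleteSpace G]
    (A : P →L[ℂ] F) (B : P →L[ℂ] G) {c : ℝ} (hc : 0 ≤ c) (h : ∀ x, ‖B x‖ ≤ c * ‖A x‖) :
    ∃ Z : F →L[ℂ] G, (∀ x, Z (A x) = B x) ∧ ‖Z‖ ≤ c := by
  let K : Submodule ℂ F := (LinearMap.range A.toLinearMap).topologicalClosure
  have hK : ∀ x, A x ∈ K := fun x => Submodule.le_topologicalClosure _ ⟨x, rfl⟩
  have : CompleteSpace K := Submodule.topologicalClosure.completeSpace _
  let e : P →ₗ[ℂ] K := A.toLinearMap.codRestrict K hK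
  have he : DenseRange e := by
    intro y
    rw [closure_subtype]
    have : (Subtype.val '' Set.range e : Set F) = Set.range A := by
      rw [← Set.range_comp]; rfl
    rw [this]
    exact y.2
  have hn : ∀ x, ‖B.toLinearMap x‖ ≤ c * ‖e x‖ := h
  -- `Z` extends `A x ↦ B x` by continuity to the closure of the range of `A` and vanishes on the
  -- orthogonal complement.
  refine ⟨B.toLinearMap.extendOfNorm e ∘L K.orthogonalProjectionOnto, fun x => ?_, ?_⟩
  · have h1 : K.orthogonalProjectionOnto (A x) = e x :=
      Submodule.orthogonalProjectionOnto_mem_subspace_eq_self (K := K) ⟨A x, hK x⟩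
    rw [comp_apply, h1, LinearMap.extendOfNorm_eq he ⟨c, hn⟩]
    rfl
  · refine opNorm_le_bound _ hc fun y => ?_
    refine (LinearMap.norm_extendOfNorm_apply_le he c hn _).trans ?_
    gcongr
    exact K.norm_orthogonalProjectionOnto_apply_le y

end Inverse

/-! ### Elementary rotations and the operator Schwarz–Pick inequality. -/

section Contractions

variable {X Y : Type*} [NormedAddCommGroup X] [InnerProductSpace ℂ X] [CompleteSpace X]
  [NormedAddCommGroup Y] [InnerProductSpace ℂ Y] [CompleteSpace Y]

section State

variable {T : X →L[ℂ] Y}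

theorem norm_defectOp_sq (hT : ‖T‖ ≤ 1) (u : X) : ‖defectOp T u‖ ^ 2 = ‖u‖ ^ 2 - ‖T u‖ ^ 2 := by
  have h : ⟪defectOp T u, defectOp T u⟫_ℂ = ⟪u, u⟫_ℂ - ⟪T u, T u⟫_ℂ := by
    rw [defectOp_symm, defectOp_mul_self hT, inner_sub_right, adjoint_inner_right]
  simp only [inner_self_eq_norm_sq_to_K] at h
  exact_mod_cast h

theorem denseRange_defectMap (T : X →L[ℂ] Y) : DenseRange (defectMap T) := by
  intro y
  rw [closure_subtype]
  have : (Subtype.val '' Set.range (defectMap T) : Set X) = Set.range (defectOp T) := by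
    rw [← Set.range_comp]; rfl
  rw [this]
  exact y.2

theorem inner_defectMap (d : defectSpace T) (x : X) : ⟪defectMap T x, d⟫_ℂ = ⟪x, defectIncl T d⟫_ℂ :=
  defectOp_symm T x d

theorem defectIncl_injective (T : X →L[ℂ] Y) : Function.Injective (defectIncl T) := by
  intro d d' h
  rw [← sub_eq_zero] at h ⊢
  rw [← map_sub] at h
  refine (denseRange_defectMap T).eq_zero_of_inner_left ℂ fun x => ?_
  rw [← inner_conj_symm, inner_defectMap, h, inner_zero_right, map_zero]

/-- If `D_T w = x - T* y'`, then `J_T` maps `(x, D_{T*} y' - T w)` to `(y', w)`. -/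
theorem rotation_apply_of_defectIncl (hT : ‖T‖ ≤ 1) {x : X} {y : Y} {w : defectSpace T}
    (h : defectIncl T w = x - adjoint T y) :
    rotation T hT (WithLp.toLp 2 (x, defectMap (adjoint T) y - defectRestrict T hT w)) =
      WithLp.toLp 2 (y, w) := by
  rw [← LinearIsometryEquiv.eq_symm_apply]
  change _ = rotationInvLin T hT _
  apply WithLp.ofLp_injective 2
  simp [rotationInvLin, -defectIncl_apply, h]

theorem norm_sq_of_defectIncl (hT : ‖T‖ ≤ 1) {x : X} {y : Y} {w : defectSpace T}
    (h : defectIncl T w = x - adjoint T y) :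
    ‖x‖ ^ 2 + ‖defectMap (adjoint T) y - defectRestrict T hT w‖ ^ 2 = ‖y‖ ^ 2 + ‖w‖ ^ 2 := by
  have h1 := congrArg (fun v => ‖v‖ ^ 2) (rotation_apply_of_defectIncl hT h)
  rwa [LinearIsometryEquiv.norm_map, WithLp.prod_norm_sq_eq_of_L2, WithLp.prod_norm_sq_eq_of_L2] at h1

end State

section SchwarzPick

variable {Θ : ℂ → X →L[ℂ] Y}

theorem IsSchurClass.norm_apply_le (hΘ : IsSchurClass Θ) {z : ℂ} (hz : z ∈ Metric.ball (0 : ℂ) 1)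
    (x : X) : ‖Θ z x‖ ≤ ‖x‖ := by
  simpa using (Θ z).le_of_opNorm_le (hΘ.2 z hz) x

theorem norm_adjoint_comp_lt {A T : X →L[ℂ] Y} (hT : ‖T‖ < 1) (hA : ‖A‖ ≤ 1) :
    ‖adjoint T ∘L A‖ < 1 := by
  refine (opNorm_comp_le _ _).trans_lt ?_
  rw [LinearIsometryEquiv.norm_map]
  nlinarith [norm_nonneg T, norm_nonneg A]

/-- When `T = Θ(0)` is a strict contraction, `D_T` is invertible and the Möbius transform `φ`
sending `T` to `0` can be written out. The Schwarz lemma gives `‖φ(z)‖ ≤ |z|`; unitarity of `J_T`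
turns this into `(1 - |z|²) ‖W x‖² ≤ ‖x‖² - ‖Θ(z) x‖²`, and Cauchy–Schwarz is applied to `⟪D u, W
x⟫`. -/
theorem schwarzPick_of_norm_lt (hΘ : IsSchurClass Θ) (h0 : ‖Θ 0‖ < 1) {z : ℂ}
    (hz : z ∈ Metric.ball (0 : ℂ) 1) (x u : X) :
    (1 - ‖z‖ ^ 2) * ‖⟪u, x - adjoint (Θ 0) (Θ z x)⟫_ℂ‖ ^ 2 ≤
      (‖x‖ ^ 2 - ‖Θ z x‖ ^ 2) * (‖u‖ ^ 2 - ‖Θ 0 u‖ ^ 2) := by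
  obtain ⟨T, hTdef⟩ : ∃ T, Θ 0 = T := ⟨_, rfl⟩
  rw [hTdef] at h0 ⊢
  have hT : ‖T‖ ≤ 1 := h0.le
  obtain ⟨D, hD⟩ : ∃ D, defectOp T = D := ⟨_, rfl⟩
  have hDu : IsUnit D := hD ▸
    (CFC.isUnit_sqrt_iff _ (one_sub_nonneg hT)).2
      (isUnit_one_sub_of_norm_lt (norm_adjoint_comp_lt h0 hT))
  obtain ⟨P, hP, hdP, hPu⟩ : ∃ P : ℂ → X →L[ℂ] X, (∀ w x, P w x = x - adjoint T (Θ w x)) ∧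
      DifferentiableOn ℂ P (Metric.ball 0 1) ∧ ∀ w ∈ Metric.ball (0 : ℂ) 1, IsUnit (P w) :=
    ⟨fun w => 1 - adjoint T ∘L Θ w, fun w x => rfl,
      (differentiableOn_const _).sub ((differentiableOn_const _).clm_comp hΘ.1),
      fun w hw => isUnit_one_sub_of_norm_lt (norm_adjoint_comp_lt h0 (hΘ.2 w hw))⟩
  have hmem : ∀ v : X, v ∈ defectSpace T := fun v => by
    rw [← apply_ringInverse_apply hDu v, ← hD]
    exact defectOp_mem T _
  obtain ⟨W, hW, hdW⟩ : ∃ W : ℂ → X →L[ℂ] X,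
      (∀ w x, W w x = Ring.inverse D (P w x)) ∧ DifferentiableOn ℂ W (Metric.ball 0 1) :=
    ⟨fun w => Ring.inverse D ∘L P w, fun w x => rfl, (differentiableOn_const _).clm_comp hdP⟩
  have hDW : ∀ w x, D (W w x) = x - adjoint T (Θ w x) := fun w x => by
    rw [hW, ← hP, apply_ringInverse_apply hDu]
  obtain ⟨V, hVdef, hdV⟩ : ∃ V : ℂ → X →L[ℂ] Y,
      (∀ w x, V w x = defectOp (adjoint T) (Θ w x) - T (W w x)) ∧
      DifferentiableOn ℂ V (Metric.ball 0 1) :=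
    ⟨fun w => defectOp (adjoint T) ∘L Θ w - T ∘L W w, fun w x => rfl,
      ((differentiableOn_const _).clm_comp hΘ.1).sub ((differentiableOn_const _).clm_comp hdW)⟩
  have hV : ∀ w x, ‖x‖ ^ 2 + ‖V w x‖ ^ 2 = ‖Θ w x‖ ^ 2 + ‖W w x‖ ^ 2 := fun w x => by
    rw [hVdef]
    exact norm_sq_of_defectIncl hT (w := ⟨W w x, hmem _⟩) (by
      rw [defectIncl_apply, hD]; exact hDW w x)
  -- `φ = V W⁻¹`; as `W = D⁻¹ P`, the inverse of `W` is `P⁻¹ D`.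
  obtain ⟨φ, hφdef, hdφ⟩ : ∃ φ : ℂ → X →L[ℂ] Y,
      (∀ w x, φ w x = V w (Ring.inverse (P w) (D x))) ∧ DifferentiableOn ℂ φ (Metric.ball 0 1) :=
    ⟨fun w => V w ∘L Ring.inverse (P w) ∘L D, fun w x => rfl,
      hdV.clm_comp ((differentiableOn_ringInverse hdP hPu).clm_comp (differentiableOn_const _))⟩
  have hφ : ∀ w ∈ Metric.ball (0 : ℂ) 1, ∀ x, φ w (W w x) = V w x := fun w hw x => by
    rw [hφdef, hW, apply_ringInverse_apply hDu, ringInverse_apply_apply (hPu w hw)]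
  have hWs : ∀ w ∈ Metric.ball (0 : ℂ) 1, ∀ v, ∃ x, W w x = v := fun w hw v =>
    ⟨Ring.inverse (P w) (D v), by
      rw [hW, apply_ringInverse_apply (hPu w hw), ringInverse_apply_apply hDu]⟩
  have hφ1 : ∀ w ∈ Metric.ball (0 : ℂ) 1, ‖φ w‖ ≤ 1 := fun w hw => by
    refine opNorm_le_bound _ zero_le_one fun v => ?_
    obtain ⟨x, rfl⟩ := hWs w hw v
    rw [hφ w hw, one_mul]
    have h1 := hV w x
    have h2 := hΘ.norm_apply_le hw x
    refine (sq_le_sq₀ (norm_nonneg _) (norm_nonneg _)).1 ?_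
    have h3 := (sq_le_sq₀ (norm_nonneg _) (norm_nonneg _)).2 h2
    linarith
  have hφ0 : φ 0 = 0 := by
    ext1 v
    obtain ⟨x, rfl⟩ := hWs 0 (by simp) v
    rw [hφ 0 (by simp)]
    have h1 : W 0 x = D x := by
      rw [hW, ← ringInverse_apply_apply hDu (D x)]
      rw [hP, hTdef, ← hD, defectOp_mul_self hT x]
    rw [hVdef, h1, ← hD, map_defectOp hT, hTdef, sub_self]
    rfl
  have hS := Complex.norm_le_norm_of_mapsTo_ball (R := 1) hdφ
    (fun w hw => by simpa using hφ1 w hw) hφ0 (mem_ball_zero_iff.1 hz)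
  have h1 := hV z x
  have h2 : ‖V z x‖ ≤ ‖z‖ * ‖W z x‖ := by
    rw [← hφ z hz]
    exact (φ z).le_of_opNorm_le hS _
  have h3 : ‖⟪u, x - adjoint T (Θ z x)⟫_ℂ‖ ≤ ‖D u‖ * ‖W z x‖ := by
    rw [← hDW, ← hD, ← defectOp_symm]
    exact norm_inner_le_norm _ _
  have h4 := norm_defectOp_sq hT u
  rw [hD] at h4
  have hz2 : 0 ≤ 1 - ‖z‖ ^ 2 := by
    have := mem_ball_zero_iff.1 hz
    nlinarith [norm_nonneg z]
  have h5 : ‖V z x‖ ^ 2 ≤ ‖z‖ ^ 2 * ‖W z x‖ ^ 2 := by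
    rw [← mul_pow]; gcongr
  have h6 : (1 - ‖z‖ ^ 2) * ‖W z x‖ ^ 2 ≤ ‖x‖ ^ 2 - ‖Θ z x‖ ^ 2 := by linarith
  calc _ ≤ (1 - ‖z‖ ^ 2) * (‖D u‖ * ‖W z x‖) ^ 2 := by gcongr
    _ = ((1 - ‖z‖ ^ 2) * ‖W z x‖ ^ 2) * ‖D u‖ ^ 2 := by ring
    _ ≤ (‖x‖ ^ 2 - ‖Θ z x‖ ^ 2) * ‖D u‖ ^ 2 := by gcongr
    _ = _ := by rw [h4]

/-- The Schwarz–Pick inequality at the points `0` and `z`. -/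
theorem schwarzPick (hΘ : IsSchurClass Θ) {z : ℂ} (hz : z ∈ Metric.ball (0 : ℂ) 1) (x u : X) :
    (1 - ‖z‖ ^ 2) * ‖⟪u, x - adjoint (Θ 0) (Θ z x)⟫_ℂ‖ ^ 2 ≤
      (‖x‖ ^ 2 - ‖Θ z x‖ ^ 2) * (‖u‖ ^ 2 - ‖Θ 0 u‖ ^ 2) := by
  -- Scaling by `r < 1` makes `Θ(0)` strictly contractive; the inequality survives the limit `r →
  -- 1`, although `D_{Θ(0)}` need not stay invertible.
  have key : ∀ r ∈ Set.Ioo (0 : ℝ) 1,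
      (1 - ‖z‖ ^ 2) * ‖⟪u, x - (r : ℂ) • (r : ℂ) • adjoint (Θ 0) (Θ z x)⟫_ℂ‖ ^ 2 ≤
      (‖x‖ ^ 2 - ‖(r : ℂ) • Θ z x‖ ^ 2) * (‖u‖ ^ 2 - ‖(r : ℂ) • Θ 0 u‖ ^ 2) := by
    intro r hr
    have hr' : ‖(r : ℂ)‖ = r := by simp [abs_of_pos hr.1]
    have h1 : IsSchurClass ((r : ℂ) • Θ) := ⟨hΘ.1.const_smul _, fun w hw => by
      rw [Pi.smul_apply, norm_smul, hr']
      have := hΘ.2 w hw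
      nlinarith [hr.1, hr.2, norm_nonneg (Θ w)]⟩
    have h2 : ‖(r : ℂ) • Θ 0‖ < 1 := by
      rw [norm_smul, hr']
      have := hΘ.norm_zero_le
      nlinarith [hr.1, hr.2, norm_nonneg (Θ 0)]
    have := schwarzPick_of_norm_lt h1 h2 hz x u
    have ha : adjoint ((r : ℂ) • Θ 0) = (r : ℂ) • adjoint (Θ 0) := by
      rw [map_smulₛₗ, Complex.conj_ofReal]
    simp only [Pi.smul_apply, ha] at this
    simpa using this
  have hl : Filter.Tendsto (fun r : ℝ => (1 - ‖z‖ ^ 2) *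
      ‖⟪u, x - (r : ℂ) • (r : ℂ) • adjoint (Θ 0) (Θ z x)⟫_ℂ‖ ^ 2) (nhdsWithin 1 (Set.Ioo 0 1))
      (nhds ((1 - ‖z‖ ^ 2) *
      ‖⟪u, x - ((1 : ℝ) : ℂ) • ((1 : ℝ) : ℂ) • adjoint (Θ 0) (Θ z x)⟫_ℂ‖ ^ 2)) :=
    (Continuous.tendsto (by fun_prop) _).mono_left nhdsWithin_le_nhds
  have hr : Filter.Tendsto (fun r : ℝ => (‖x‖ ^ 2 - ‖(r : ℂ) • Θ z x‖ ^ 2) *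
      (‖u‖ ^ 2 - ‖(r : ℂ) • Θ 0 u‖ ^ 2)) (nhdsWithin 1 (Set.Ioo 0 1))
      (nhds ((‖x‖ ^ 2 - ‖((1 : ℝ) : ℂ) • Θ z x‖ ^ 2) *
      (‖u‖ ^ 2 - ‖((1 : ℝ) : ℂ) • Θ 0 u‖ ^ 2))) :=
    (Continuous.tendsto (by fun_prop) _).mono_left nhdsWithin_le_nhds
  have : (nhdsWithin (1 : ℝ) (Set.Ioo 0 1)).NeBot := by
    rw [← mem_closure_iff_nhdsWithin_neBot, closure_Ioo zero_ne_one]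
    simp
  have := le_of_tendsto_of_tendsto hl hr (Filter.eventually_of_mem self_mem_nhdsWithin key)
  simpa using this

end SchwarzPick

end Contractions

theorem norm_inner_self_eq_norm_sq {E : Type*} [NormedAddCommGroup E] [InnerProductSpace ℂ E]
    (x : E) : ‖⟪x, x⟫_ℂ‖ = ‖x‖ ^ 2 := by
  rw [inner_self_eq_norm_sq_to_K]; simp

/-! ### The feedback transform `Z ↦ Z (1 + R Z)⁻¹` and division by `z`. -/

section Feedback

variable {E F : Type*} [NormedAddCommGroup E] [InnerProductSpace ℂ E] [CompleteSpace E]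
  [NormedAddCommGroup F] [InnerProductSpace ℂ F] [CompleteSpace F]

theorem one_sub_comp_feedback {R : F →L[ℂ] E} {Z : E →L[ℂ] F} (hu : IsUnit (1 + R ∘L Z)) :
    1 - R ∘L (Z ∘L Ring.inverse (1 + R ∘L Z)) = Ring.inverse (1 + R ∘L Z) := by
  ext1 x
  have h := apply_ringInverse_apply hu x
  simp only [sub_apply, comp_apply, add_apply, one_apply_eq_self] at h ⊢
  rw [sub_eq_iff_eq_add, h]

/-- With `Q = Z (1 + R Z)⁻¹` one has `1 - R Q = (1 + R Z)⁻¹`, so `Z` is recovered from `Q`. The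
Möbius representation of `Θ` involves `Z` only through `Q`; hence both the uniqueness and the
holomorphy of `Z` rest on this inversion. -/
theorem eq_feedback_inverse {R : F →L[ℂ] E} {Z : E →L[ℂ] F} (hu : IsUnit (1 + R ∘L Z)) :
    Z = (Z ∘L Ring.inverse (1 + R ∘L Z)) ∘L
      Ring.inverse (1 - R ∘L (Z ∘L Ring.inverse (1 + R ∘L Z))) := by
  rw [one_sub_comp_feedback hu]
  have hu' : IsUnit (Ring.inverse (1 + R ∘L Z)) := hu.ringInverse
  ext1 x
  rw [comp_apply, comp_apply, apply_ringInverse_apply hu']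

/-- The Neumann bound supplies the local boundedness without which weak holomorphy of `Q` would not
suffice. -/
theorem norm_feedback_le {R : F →L[ℂ] E} (hR : ‖R‖ ≤ 1) {Z : E →L[ℂ] F} {r : ℝ} (hr : r < 1)
    (hZ : ‖Z‖ ≤ r) : ‖Z ∘L Ring.inverse (1 + R ∘L Z)‖ ≤ r * (1 - r)⁻¹ := by
  have hr0 : 0 ≤ r := (norm_nonneg _).trans hZ
  have hr1 : 0 < 1 - r := by linarith
  have hRZ : ‖R ∘L Z‖ ≤ r := (opNorm_comp_le _ _).trans (by nlinarith [norm_nonneg R, norm_nonneg Z])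
  have hu := isUnit_one_add_of_norm_lt (hRZ.trans_lt hr)
  refine (opNorm_comp_le _ _).trans ?_
  gcongr
  refine opNorm_le_bound _ (by positivity) fun x => ?_
  set v := Ring.inverse (1 + R ∘L Z) x with hv
  have h1 : v = x - (R ∘L Z) v := by
    rw [eq_sub_iff_add_eq]
    exact apply_ringInverse_apply hu x
  have h2 : ‖v‖ ≤ ‖x‖ + r * ‖v‖ := by
    conv_lhs => rw [h1]
    exact (norm_sub_le _ _).trans (by gcongr; exact (R ∘L Z).le_of_opNorm_le hRZ v)
  rw [inv_mul_eq_div, le_div_iff₀ hr1]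
  linarith

theorem differentiableOn_of_feedback {R : F →L[ℂ] E} {Z : ℂ → E →L[ℂ] F} {s : Set ℂ}
    (hu : ∀ z ∈ s, IsUnit (1 + R ∘L Z z))
    (hQ : DifferentiableOn ℂ (fun z => Z z ∘L Ring.inverse (1 + R ∘L Z z)) s) :
    DifferentiableOn ℂ Z s := by
  have h1 : DifferentiableOn ℂ
      (fun z => 1 - R ∘L (Z z ∘L Ring.inverse (1 + R ∘L Z z))) s :=
    (differentiableOn_const (1 : E →L[ℂ] E)).sub ((differentiableOn_const R).clm_comp hQ)
  refine (hQ.clm_comp (differentiableOn_ringInverse h1 fun z hz => ?_)).congr fun z hz =>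
    eq_feedback_inverse (hu z hz)
  rw [one_sub_comp_feedback (hu z hz)]
  exact (hu z hz).ringInverse

/-- A Schur class function with `‖Z(z)‖ ≤ |z|` is `z` times a Schur class function. -/
theorem isSchurClass_dslope {Z : ℂ → E →L[ℂ] F} (hd : DifferentiableOn ℂ Z (Metric.ball 0 1))
    (hZ : ∀ z ∈ Metric.ball (0 : ℂ) 1, ‖Z z‖ ≤ ‖z‖) :
    IsSchurClass (dslope Z 0) ∧ ∀ z, z • dslope Z 0 z = Z z := by
  have h0 : Z 0 = 0 := by simpa using hZ 0 (by simp)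
  refine ⟨⟨(Complex.differentiableOn_dslope (Metric.ball_mem_nhds 0 one_pos)).2 hd,
    fun z hz => ?_⟩, fun z => ?_⟩
  · have := Complex.norm_dslope_le_div_of_mapsTo_ball (R₂ := 1) hd (fun w hw => by
      rw [h0]
      simpa using (hZ w hw).trans (mem_ball_zero_iff.1 hw).le) hz
    simpa using this
  · have := sub_smul_dslope Z 0 z
    rwa [h0, sub_zero, sub_zero] at this

end Feedback

/-! ### Existence and uniqueness of Schur iterates. -/

section SchurIterates

variable {X Y : Type*} [NormedAddCommGroup X] [InnerProductSpace ℂ X] [CompleteSpace X]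
  [NormedAddCommGroup Y] [InnerProductSpace ℂ Y] [CompleteSpace Y]

theorem norm_adjointRestrict_le (T : X →L[ℂ] Y) (hT : ‖T‖ ≤ 1) : ‖adjointRestrict T hT‖ ≤ 1 :=
  opNorm_le_bound _ zero_le_one fun y =>
    (adjoint T).le_of_opNorm_le (by rwa [LinearIsometryEquiv.norm_map]) y

section SchurAlgorithm

variable {Θ : ℂ → X →L[ℂ] Y}

/-- Here `W` plays the part of `D_{Θ(0)}⁻¹ (I - Θ(0)* Θ(z))`, although `D_{Θ(0)}` may not be
invertible. Douglas' lemma factors the adjoint `B = I - Θ(z)* Θ(0)` through `D_{Θ(0)}`, and `W` is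
the adjoint of the factor. -/
theorem exists_defectIncl_comp_eq (hΘ : IsSchurClass Θ) {z : ℂ} (hz : z ∈ Metric.ball (0 : ℂ) 1) :
    ∃ W : X →L[ℂ] defectSpace (Θ 0),
      (∀ x, defectIncl (Θ 0) (W x) = x - adjoint (Θ 0) (Θ z x)) ∧
      ∀ x, (1 - ‖z‖ ^ 2) * ‖W x‖ ^ 2 ≤ ‖x‖ ^ 2 - ‖Θ z x‖ ^ 2 := by
  have hz1 := mem_ball_zero_iff.1 hz
  have hδ : 0 < 1 - ‖z‖ ^ 2 := by nlinarith [norm_nonneg z]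
  let B : X →L[ℂ] X := 1 - adjoint (Θ z) ∘L Θ 0
  have hB : ∀ u x, ⟪B u, x⟫_ℂ = ⟪u, x - adjoint (Θ 0) (Θ z x)⟫_ℂ := fun u x => by
    change ⟪u - adjoint (Θ z) (Θ 0 u), x⟫_ℂ = _
    rw [inner_sub_left, inner_sub_right, adjoint_inner_left, adjoint_inner_right]
  have hnorm : ∀ u, ‖defectMap (Θ 0) u‖ ^ 2 = ‖u‖ ^ 2 - ‖Θ 0 u‖ ^ 2 :=
    norm_defectOp_sq hΘ.norm_zero_le
  have hdef : ∀ x, 0 ≤ ‖x‖ ^ 2 - ‖Θ z x‖ ^ 2 := fun x => by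
    have := hΘ.norm_apply_le hz x
    have := (sq_le_sq₀ (norm_nonneg _) (norm_nonneg _)).2 this
    linarith
  obtain ⟨V, hV, -⟩ := exists_comp_eq_of_norm_le (defectMap (Θ 0)) B
    (c := (√(1 - ‖z‖ ^ 2))⁻¹) (by positivity) fun u => by
      -- With `x = B u` the inner product becomes `‖B u‖²`; cancelling one factor `‖B u‖²` gives the
      -- constant `(1 - |z|²)^(-1/2)`.
      have h1 := schwarzPick hΘ hz (B u) u
      rw [← hB, norm_inner_self_eq_norm_sq, ← hnorm] at h1
      rw [inv_mul_eq_div, le_div_iff₀ (Real.sqrt_pos.2 hδ)]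
      refine (sq_le_sq₀ (by positivity) (norm_nonneg _)).1 ?_
      rw [mul_pow, Real.sq_sqrt hδ.le]
      rcases (norm_nonneg (B u)).eq_or_lt with h0 | h0
      · rw [← h0]; simp
      · have h3 : 0 < ‖B u‖ ^ 2 := by positivity
        refine le_of_mul_le_mul_left ?_ h3
        refine le_trans (by linarith) (h1.trans ?_)
        gcongr
        nlinarith [norm_nonneg (Θ z (B u))]
  have hVW : ∀ u x, ⟪defectMap (Θ 0) u, adjoint V x⟫_ℂ = ⟪u, x - adjoint (Θ 0) (Θ z x)⟫_ℂ :=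
    fun u x => by rw [adjoint_inner_right, hV, hB]
  refine ⟨adjoint V, fun x => ext_inner_left ℂ fun u => ?_, fun x => ?_⟩
  · rw [← inner_defectMap, hVW]
  · have key : ∀ d : defectSpace (Θ 0), (1 - ‖z‖ ^ 2) * ‖⟪d, adjoint V x⟫_ℂ‖ ^ 2 ≤
        (‖x‖ ^ 2 - ‖Θ z x‖ ^ 2) * ‖d‖ ^ 2 := fun d => by
      refine (denseRange_defectMap (Θ 0)).induction_on d
        (isClosed_le (by fun_prop) (by fun_prop)) fun u => ?_
      rw [hVW, hnorm]
      exact schwarzPick hΘ hz x u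
    -- Testing against `d = W x` itself turns Schwarz–Pick into the required bound on `‖W x‖`, which
    -- depends on `x` through its defect.
    have h1 := key (adjoint V x)
    rw [norm_inner_self_eq_norm_sq] at h1
    rcases (norm_nonneg (adjoint V x)).eq_or_lt with h0 | h0
    · rw [← h0]; simpa using hdef x
    · have h3 : 0 < ‖adjoint V x‖ ^ 2 := by positivity
      refine le_of_mul_le_mul_right ?_ h3
      linarith

/-- `J_{Θ(0)}` sends `(x, V x)` to `(Θ(z) x, W x)`, so `‖V x‖² = ‖Θ(z) x‖² + ‖W x‖² - ‖x‖² ≤ |z|² ‖W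
x‖²`. Douglas' lemma gives `V = Z W`. The second row of the rotation then reads `D x = (1 + Θ(0)* Z)
W x`; solving it for `W x` and inserting this in the first row yields the formula. -/
theorem exists_feedback_eq (hΘ : IsSchurClass Θ) {z : ℂ} (hz : z ∈ Metric.ball (0 : ℂ) 1) :
    ∃ Z : defectSpace (Θ 0) →L[ℂ] defectSpace (adjoint (Θ 0)), ‖Z‖ ≤ ‖z‖ ∧
      Θ z = Θ 0 + defectIncl (adjoint (Θ 0)) ∘L Z ∘L
        Ring.inverse (1 + adjointRestrict (Θ 0) hΘ.norm_zero_le ∘L Z) ∘L defectMap (Θ 0) := by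
  obtain ⟨W, hW, hWn⟩ := exists_defectIncl_comp_eq hΘ hz
  have hz1 := mem_ball_zero_iff.1 hz
  have hT := hΘ.norm_zero_le
  let V : X →L[ℂ] defectSpace (adjoint (Θ 0)) :=
    defectMap (adjoint (Θ 0)) ∘L Θ z - defectRestrict (Θ 0) hT ∘L W
  have hrot : ∀ x, rotation (Θ 0) hT (WithLp.toLp 2 (x, V x)) = WithLp.toLp 2 (Θ z x, W x) :=
    fun x => rotation_apply_of_defectIncl hT (hW x)
  obtain ⟨Z, hZ, hZn⟩ := exists_comp_eq_of_norm_le W V (norm_nonneg z) fun x => by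
    have h1 := norm_sq_of_defectIncl hT (hW x)
    have h2 := hWn x
    refine (sq_le_sq₀ (norm_nonneg _) (by positivity)).1 ?_
    rw [mul_pow]
    change ‖defectMap (adjoint (Θ 0)) (Θ z x) - defectRestrict (Θ 0) hT (W x)‖ ^ 2 ≤ _
    linarith
  refine ⟨Z, hZn, ?_⟩
  have hu : IsUnit (1 + adjointRestrict (Θ 0) hT ∘L Z) := by
    refine isUnit_one_add_of_norm_lt ((opNorm_comp_le _ _).trans_lt ?_)
    nlinarith [norm_adjointRestrict_le (Θ 0) hT, norm_nonneg Z]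
  ext1 x
  have h1 := congrArg WithLp.fst (hrot x)
  have h2 := congrArg WithLp.snd (hrot x)
  change Θ 0 x + defectIncl (adjoint (Θ 0)) (V x) = Θ z x at h1
  change defectMap (Θ 0) x - adjointRestrict (Θ 0) hT (V x) = W x at h2
  have h3 : defectMap (Θ 0) x = (1 + adjointRestrict (Θ 0) hT ∘L Z) (W x) := by
    rw [sub_eq_iff_eq_add] at h2
    rw [h2, ← hZ]
    rfl
  change Θ z x = Θ 0 x + defectIncl (adjoint (Θ 0)) (Z (Ring.inverse
    (1 + adjointRestrict (Θ 0) hT ∘L Z) (defectMap (Θ 0) x)))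
  rw [h3, ringInverse_apply_apply hu, hZ, h1]

/-- Every Schur class function has a Schur iterate. -/
theorem exists_isSchurIterate (hΘ : IsSchurClass Θ) : ∃ Θ', IsSchurIterate Θ hΘ Θ' := by
  have hT := hΘ.norm_zero_le
  choose! Z hZ hΘZ using fun z (hz : z ∈ Metric.ball (0 : ℂ) 1) => exists_feedback_eq hΘ hz
  have hR := norm_adjointRestrict_le (Θ 0) hT
  have hu : ∀ z ∈ Metric.ball (0 : ℂ) 1, IsUnit (1 + adjointRestrict (Θ 0) hT ∘L Z z) :=
    fun z hz => by
      refine isUnit_one_add_of_norm_lt ((opNorm_comp_le _ _).trans_lt ?_)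
      nlinarith [hZ z hz, norm_nonneg (Z z), mem_ball_zero_iff.1 hz]
  -- `Z` was chosen separately at each `z`. Between vectors of the dense ranges of `D_{Θ(0)}` and
  -- `D_{Θ(0)*}`, the matrix elements of `Q` are matrix elements of `Θ(z) - Θ(0)`, hence
  -- holomorphic.
  have hd : DifferentiableOn ℂ Z (Metric.ball 0 1) := by
    refine differentiableOn_of_feedback hu ?_
    refine differentiableOn_of_inner_dense Metric.isOpen_ball (fun z hz => ?_)
      (denseRange_defectMap (Θ 0)) (denseRange_defectMap (adjoint (Θ 0))) ?_
    · obtain ⟨r, hr0, hr1⟩ := exists_between (mem_ball_zero_iff.1 hz)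
      refine ⟨r * (1 - r)⁻¹, ?_⟩
      filter_upwards [Metric.isOpen_ball.mem_nhds (mem_ball_zero_iff.2 hr0)] with w hw
      have hw' := mem_ball_zero_iff.1 hw
      exact norm_feedback_le hR hr1 ((hZ w (mem_ball_zero_iff.2 (hw'.trans hr1))).trans hw'.le)
    · rintro _ ⟨x, rfl⟩ _ ⟨y, rfl⟩
      have hL : DifferentiableOn ℂ (fun z => ⟪y, (Θ z - Θ 0) x⟫_ℂ) (Metric.ball 0 1) :=
        ((innerSL ℂ y ∘L ContinuousLinearMap.apply ℂ Y x).differentiable.comp_differentiableOn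
          (hΘ.1.sub_const (Θ 0)))
      refine hL.congr fun z hz => ?_
      rw [inner_defectMap]
      conv_rhs => rw [hΘZ z hz, add_sub_cancel_left]
      rfl
  obtain ⟨h1, h2⟩ := isSchurClass_dslope hd hZ
  refine ⟨dslope Z 0, h1, ?_⟩
  simp only [h2]
  exact ⟨⟨hd, fun z hz => (hZ z hz).trans (mem_ball_zero_iff.1 hz).le⟩, fun z hz =>
    ⟨hu z hz, hΘZ z hz⟩⟩

/-- The Möbius parameter is unique. -/
theorem IsMobiusParameter.eqOn {hΘ : IsSchurClass Θ}
    {Z Z' : ℂ → defectSpace (Θ 0) →L[ℂ] defectSpace (adjoint (Θ 0))}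
    (h : IsMobiusParameter Θ hΘ Z) (h' : IsMobiusParameter Θ hΘ Z') :
    Set.EqOn Z Z' (Metric.ball 0 1) := fun z hz => by
  obtain ⟨hu, hz1⟩ := h.2 z hz
  obtain ⟨hu', hz1'⟩ := h'.2 z hz
  -- `D_{Θ(0)}` has dense range and `D_{Θ(0)*}` is injective on its defect space, so both can be
  -- cancelled.
  have hQ : Z z ∘L Ring.inverse (1 + adjointRestrict (Θ 0) hΘ.norm_zero_le ∘L Z z) =
      Z' z ∘L Ring.inverse (1 + adjointRestrict (Θ 0) hΘ.norm_zero_le ∘L Z' z) := by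
    refine DFunLike.coe_injective ((denseRange_defectMap (Θ 0)).equalizer
      (ContinuousLinearMap.continuous _) (ContinuousLinearMap.continuous _) (funext fun x => ?_))
    have h1 := hz1.symm.trans hz1'
    exact defectIncl_injective _ (congrArg (fun A : X →L[ℂ] Y => A x) (add_left_cancel h1))
  rw [eq_feedback_inverse hu, hQ, ← eq_feedback_inverse hu']

/-- The Schur iterate is unique. -/
theorem IsSchurIterate.eqOn {hΘ : IsSchurClass Θ}
    {Θ₁ Θ₂ : ℂ → defectSpace (Θ 0) →L[ℂ] defectSpace (adjoint (Θ 0))}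
    (h₁ : IsSchurIterate Θ hΘ Θ₁) (h₂ : IsSchurIterate Θ hΘ Θ₂) :
    Set.EqOn Θ₁ Θ₂ (Metric.ball 0 1) := by
  have hne : ∀ z ∈ Metric.ball (0 : ℂ) 1, z ≠ 0 → Θ₁ z = Θ₂ z := fun z hz h0 =>
    smul_right_injective _ h0 (h₁.2.eqOn h₂.2 hz)
  intro z hz
  rcases eq_or_ne z 0 with rfl | h0
  -- The Möbius parameter `z Θ'(z)` does not see `Θ'(0)`; that value is fixed by continuity.
  · have hb := Metric.ball_mem_nhds (0 : ℂ) one_pos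
    have hc₁ : ContinuousAt Θ₁ 0 := h₁.1.1.continuousOn.continuousAt hb
    have hc₂ : ContinuousAt Θ₂ 0 := h₂.1.1.continuousOn.continuousAt hb
    refine tendsto_nhds_unique (hc₁.mono_left (nhdsWithin_le_nhds (s := {0}ᶜ)))
      ((hc₂.mono_left nhdsWithin_le_nhds).congr' ?_)
    filter_upwards [self_mem_nhdsWithin, nhdsWithin_le_nhds hb] with w hw hwb
    exact (hne w hwb hw).symm
  · exact hne z hz h0

/-- The defining property of the Schur iterate, in terms of the elementary rotation. -/
theorem IsSchurIterate.exists_rotation_eq {hΘ : IsSchurClass Θ}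
    {Θ' : ℂ → defectSpace (Θ 0) →L[ℂ] defectSpace (adjoint (Θ 0))}
    (h : IsSchurIterate Θ hΘ Θ') {z : ℂ} (hz : z ∈ Metric.ball (0 : ℂ) 1) (x : X) :
    ∃ w : defectSpace (Θ 0), rotation (Θ 0) hΘ.norm_zero_le (WithLp.toLp 2 (x, z • Θ' z w)) =
      WithLp.toLp 2 (Θ z x, w) := by
  obtain ⟨hu, hz1⟩ := h.2.2 z hz
  refine ⟨Ring.inverse (1 + adjointRestrict (Θ 0) hΘ.norm_zero_le ∘L (z • Θ' z))
    (defectMap (Θ 0) x), ?_⟩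
  set w := Ring.inverse (1 + adjointRestrict (Θ 0) hΘ.norm_zero_le ∘L (z • Θ' z))
    (defectMap (Θ 0) x) with hw
  have h1 := apply_ringInverse_apply hu (defectMap (Θ 0) x)
  rw [← hw] at h1
  apply WithLp.ofLp_injective 2
  refine Prod.ext ?_ ?_
  · exact (congrArg (fun A : X →L[ℂ] Y => A x) hz1).symm
  · exact sub_eq_iff_eq_add.2 h1.symm

end SchurAlgorithm

end SchurIterates

theorem SchurFunction.isSchurIterate_next (S : SchurFunction) :
    IsSchurIterate S.toFun S.isSchur S.next.toFun := by
  have h := exists_isSchurIterate S.isSchur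
  have e : S.next.toFun = h.choose := dif_pos h
  rw [e]
  exact h.choose_spec

theorem SchurFunction.isSchurIterate_iterate (S : SchurFunction) (n : ℕ) :
    IsSchurIterate (S.iterate n).toFun (S.iterate n).isSchur (S.iterate (n + 1)).toFun :=
  (S.iterate n).isSchurIterate_next

/-! ### The transfer function of the CMV matrix. -/

namespace SchurFunction

variable (S : SchurFunction)

/-- The Schur iterate `Θₙ₊₁`, as an operator function from `𝔇_{Γₙ}` to `𝔇_{Γₙ*}`. -/
def schurIterate (n : ℕ) : ℂ → S.D n →L[ℂ] S.Dstar n := (S.iterate (n + 1)).toFun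

theorem norm_schurIterate_apply_le (n : ℕ) {z : ℂ} (hz : z ∈ Metric.ball (0 : ℂ) 1) (a : S.D n) :
    ‖S.schurIterate n z a‖ ≤ ‖a‖ :=
  (S.iterate (n + 1)).isSchur.norm_apply_le hz a

theorem exists_rotZero_eq {z : ℂ} (hz : z ∈ Metric.ball (0 : ℂ) 1) (x : S.X) :
    ∃ w : S.D (2 * 0), S.rotZero (WithLp.toLp 2 (x, z • S.schurIterate (2 * 0) z w)) =
      WithLp.toLp 2 (S.toFun z x, w) :=
  (S.isSchurIterate_iterate 0).exists_rotation_eq hz x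

theorem exists_rotSucc_eq {z : ℂ} (hz : z ∈ Metric.ball (0 : ℂ) 1) (n : ℕ) (x : S.D n) :
    ∃ w : S.D (n + 1), S.rotSucc n (WithLp.toLp 2 (x, z • S.schurIterate (n + 1) z w)) =
      WithLp.toLp 2 (S.schurIterate n z x, w) :=
  (S.isSchurIterate_iterate (n + 1)).exists_rotation_eq hz x

/-- The output `w` of one rotation relation is the input of the next. The index is shifted:
`schurIterate n` is `Θₙ₊₁`. The factor `z` on `w n` appears because `M₀` acts on `z k`, whereas the
even rotations take `d n` directly from its output. -/
theorem exists_state_sequences {z : ℂ} (hz : z ∈ Metric.ball (0 : ℂ) 1) (x : S.X) :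
    ∃ (w : ∀ n : ℕ, S.D (2 * n)) (d : ∀ n : ℕ, S.D (2 * n + 1)),
      S.rotZero (WithLp.toLp 2 (x, z • S.schurIterate (2 * 0) z (w 0))) =
        WithLp.toLp 2 (S.toFun z x, w 0) ∧
      (∀ n, S.rotSucc (2 * n)
          (WithLp.toLp 2 (z • w n, z • S.schurIterate (2 * n + 1) z (d n))) =
        WithLp.toLp 2 (S.schurIterate (2 * n) z (z • w n), d n)) ∧
      ∀ n, S.rotEven n
          (WithLp.toLp 2 (d n, z • S.schurIterate (2 * (n + 1)) z (w (n + 1)))) =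
        WithLp.toLp 2 (S.schurIterate (2 * n + 1) z (d n), w (n + 1)) := by
  obtain ⟨w₀, hw₀⟩ := S.exists_rotZero_eq hz x
  choose f hf using S.exists_rotSucc_eq hz
  let w : ∀ n : ℕ, S.D (2 * n) := fun n =>
    Nat.rec (motive := fun n => S.D (2 * n)) w₀ (fun n v => f (2 * n + 1) (f (2 * n) (z • v))) n
  exact ⟨w, fun n => f (2 * n) (z • w n), hw₀, fun n => hf (2 * n) (z • w n),
    fun n => hf (2 * n + 1) (f (2 * n) (z • w n))⟩

theorem summable_of_telescoping {c : ℝ} (hc : 0 < c) {e p : ℕ → ℝ} (he : ∀ n, 0 ≤ e n)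
    (hp : ∀ n, 0 ≤ p n) (h : ∀ n, c * p n + e (n + 1) ≤ e n) : Summable p := by
  refine summable_of_sum_range_le (c := e 0 / c) hp fun n => ?_
  have key : ∀ n, c * ∑ i ∈ Finset.range n, p i + e n ≤ e 0 := fun n => by
    induction n with
    | zero => simp
    | succ n ih => rw [Finset.sum_range_succ, mul_add]; linarith [h n]
  rw [le_div_iff₀ hc]
  linarith [key n, he n]

/-- For `|z| < 1`, the block operator CMV matrix maps `(x, z k)` to `(Θ(z) x, k)` for a suitable
`k`: its transfer function is `Θ`. -/
theorem exists_U₀_eq {z : ℂ} (hz : z ∈ Metric.ball (0 : ℂ) 1) (x : S.X) :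
    ∃ k : S.H₀, S.U₀ (WithLp.toLp 2 (x, z • k)) = WithLp.toLp 2 (S.toFun z x, k) := by
  obtain ⟨w, d, h0, hodd, heven⟩ := S.exists_state_sequences hz x
  have hz1 := mem_ball_zero_iff.1 hz
  have hδ : 0 < 1 - ‖z‖ ^ 2 := by nlinarith [norm_nonneg z]
  have nodd : ∀ n, ‖z‖ ^ 2 * ‖w n‖ ^ 2 + ‖z‖ ^ 2 * ‖S.schurIterate (2 * n + 1) z (d n)‖ ^ 2 =
      ‖S.schurIterate (2 * n) z (z • w n)‖ ^ 2 + ‖d n‖ ^ 2 := fun n => by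
    have h := congrArg (fun v => ‖v‖ ^ 2) (hodd n)
    rw [LinearIsometryEquiv.norm_map, WithLp.prod_norm_sq_eq_of_L2,
      WithLp.prod_norm_sq_eq_of_L2] at h
    simpa only [WithLp.toLp_fst, WithLp.toLp_snd, norm_smul, mul_pow] using h
  have neven : ∀ n, ‖d n‖ ^ 2 + ‖S.schurIterate (2 * (n + 1)) z (z • w (n + 1))‖ ^ 2 =
      ‖S.schurIterate (2 * n + 1) z (d n)‖ ^ 2 + ‖w (n + 1)‖ ^ 2 := fun n => by
    have h := congrArg (fun v => ‖v‖ ^ 2) (heven n)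
    rw [LinearIsometryEquiv.norm_map, WithLp.prod_norm_sq_eq_of_L2,
      WithLp.prod_norm_sq_eq_of_L2] at h
    rw [map_smul]
    exact h
  -- With `e n = |z|² ‖w n‖² - ‖Θ₂ₙ₊₁(z) (z w n)‖² ≥ 0`, the two norm identities combine to `e n - e
  -- (n + 1) = (1 - |z|²) p n`, where `p n` is the summand.
  have hsum : Summable fun n => ‖S.schurIterate (2 * n + 1) z (d n)‖ ^ 2 + ‖w (n + 1)‖ ^ 2 := by
    refine summable_of_telescoping hδ
      (e := fun n => ‖z‖ ^ 2 * ‖w n‖ ^ 2 - ‖S.schurIterate (2 * n) z (z • w n)‖ ^ 2)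
      (fun n => ?_) (fun n => by positivity) fun n => ?_
    · have h1 := S.norm_schurIterate_apply_le (2 * n) hz (z • w n)
      have h2 := (sq_le_sq₀ (norm_nonneg _) (norm_nonneg _)).2 h1
      rw [norm_smul, mul_pow] at h2
      linarith
    · have h1 := nodd n
      have h2 := neven n
      linarith
  have hs1 : Summable fun n => ‖S.schurIterate (2 * n + 1) z (d n)‖ ^ 2 :=
    hsum.of_nonneg_of_le (fun _ => by positivity) fun n => by
      have := sq_nonneg ‖w (n + 1)‖; linarith
  have hs2 : Summable fun n => ‖w n‖ ^ 2 := (summable_nat_add_iff 1).1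
    (hsum.of_nonneg_of_le (fun _ => by positivity) fun n => by
      have := sq_nonneg ‖S.schurIterate (2 * n + 1) z (d n)‖; linarith)
  have hk : Memℓp (fun n => WithLp.toLp 2 (w n, S.schurIterate (2 * n + 1) z (d n)) :
      ∀ n, WithLp 2 (S.D (2 * n) × S.Dstar (2 * n + 1))) 2 := by
    rw [memlp_two_iff]
    simp only [WithLp.prod_norm_sq_eq_of_L2]
    exact hs2.add hs1
  refine ⟨⟨_, hk⟩, ?_⟩
  change (regroup S.Y (fun n => S.D (2 * n)) (fun n => S.Dstar (2 * n + 1))).symm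
    (S.evenDiag (regroup S.X (fun n => S.Dstar (2 * n)) (fun n => S.D (2 * n + 1))
      (S.M₀ _))) = _
  rw [LinearIsometryEquiv.symm_apply_eq]
  have hodd' : ∀ n, S.rotSucc (2 * n)
      (z • WithLp.toLp 2 (w n, S.schurIterate (2 * n + 1) z (d n))) =
        WithLp.toLp 2 (S.schurIterate (2 * n) z (z • w n), d n) := hodd
  have hV : ∀ n, (S.V₀ (z • ⟨_, hk⟩ : S.H₀)) n =
      WithLp.toLp 2 (S.schurIterate (2 * n) z (z • w n), d n) := hodd'
  apply WithLp.ofLp_injective 2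
  refine Prod.ext ?_ ?_
  · refine Eq.trans ?_ h0
    change S.rotZero (WithLp.toLp 2 (x, ((S.V₀ (z • ⟨_, hk⟩ : S.H₀)) 0).fst)) = _
    rw [hV 0, map_smul]
    rfl
  · refine lp.ext (funext fun n => ?_)
    refine Eq.trans ?_ (heven n)
    change S.rotEven n (WithLp.toLp 2 (((S.V₀ (z • ⟨_, hk⟩ : S.H₀)) n).snd,
      ((S.V₀ (z • ⟨_, hk⟩ : S.H₀)) (n + 1)).fst)) = _
    rw [hV n, hV (n + 1), map_smul (S.schurIterate (2 * (n + 1)) z)]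
    rfl

end SchurFunction

theorem hasSum_pow_smul_unique {E : Type*} [NormedAddCommGroup E] [NormedSpace ℂ E]
    {a b : ℕ → E} {f : ℂ → E}
    (ha : ∀ z ∈ Metric.ball (0 : ℂ) 1, HasSum (fun n => z ^ n • a n) (f z))
    (hb : ∀ z ∈ Metric.ball (0 : ℂ) 1, HasSum (fun n => z ^ n • b n) (f z)) : a = b := by
  let p : (ℕ → E) → FormalMultilinearSeries ℂ ℂ E := fun c n =>
    ContinuousMultilinearMap.mkPiRing ℂ (Fin n) (c n)
  have hp : ∀ c n, (p c).coeff n = c n := fun c n => by simp [p, FormalMultilinearSeries.coeff]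
  have key : ∀ c : ℕ → E, (∀ z ∈ Metric.ball (0 : ℂ) 1, HasSum (fun n => z ^ n • c n) (f z)) →
      HasFPowerSeriesAt f (p c) 0 := fun c hc => by
    refine hasFPowerSeriesAt_iff.2 ?_
    filter_upwards [Metric.ball_mem_nhds (0 : ℂ) one_pos] with z hz
    simpa only [hp, zero_add] using hc z hz
  funext n
  rw [← hp a n, (key a ha).eq_formalMultilinearSeries (key b hb), hp]

/-! ### Unitary dilations, their compressions and minimality. -/

section Dilation

variable {𝔐 H H' : Type*} [NormedAddCommGroup 𝔐] [InnerProductSpace ℂ 𝔐] [CompleteSpace 𝔐]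
  [NormedAddCommGroup H] [InnerProductSpace ℂ H] [CompleteSpace H]
  [NormedAddCommGroup H'] [InnerProductSpace ℂ H'] [CompleteSpace H']

theorem norm_adjoint_isometry_apply_le (ι : 𝔐 →ₗᵢ[ℂ] H) (h : H) :
    ‖adjoint ι.toContinuousLinearMap h‖ ≤ ‖h‖ := by
  have h1 : ‖adjoint ι.toContinuousLinearMap‖ ≤ 1 := by
    rw [LinearIsometryEquiv.norm_map]
    exact ι.norm_toContinuousLinearMap_le
  simpa using (adjoint ι.toContinuousLinearMap).le_of_opNorm_le h1 h

/-- The compression `P_𝔐 Uⁿ|𝔐`. -/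
def compression (ι : 𝔐 →ₗᵢ[ℂ] H) (U : H ≃ₗᵢ[ℂ] H) (n : ℤ) : 𝔐 →L[ℂ] 𝔐 :=
  adjoint ι.toContinuousLinearMap ∘L (U ^ n).toContinuousLinearEquiv.toContinuousLinearMap ∘L
    ι.toContinuousLinearMap

theorem compression_apply (ι : 𝔐 →ₗᵢ[ℂ] H) (U : H ≃ₗᵢ[ℂ] H) (n : ℤ) (x : 𝔐) :
    compression ι U n x = adjoint ι.toContinuousLinearMap ((U ^ n) (ι x)) := rfl

theorem norm_compression_le (ι : 𝔐 →ₗᵢ[ℂ] H) (U : H ≃ₗᵢ[ℂ] H) (n : ℤ) :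
    ‖compression ι U n‖ ≤ 1 :=
  opNorm_le_bound _ zero_le_one fun x => by
    rw [compression_apply, one_mul]
    exact (norm_adjoint_isometry_apply_le ι _).trans (by simp)

theorem compression_neg (ι : 𝔐 →ₗᵢ[ℂ] H) (U : H ≃ₗᵢ[ℂ] H) (n : ℤ) :
    compression ι U (-n) = adjoint (compression ι U n) := by
  refine ContinuousLinearMap.ext fun x => ext_inner_right ℂ fun y => ?_
  have h : (U ^ n) ((U ^ (-n)) (ι x)) = ι x := by
    change (U ^ n * U ^ (-n)) (ι x) = ι x
    rw [← zpow_add, add_neg_cancel, zpow_zero]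
    rfl
  rw [adjoint_inner_left, compression_apply, compression_apply, adjoint_inner_left,
    adjoint_inner_right, ← (U ^ n).inner_map_map, h]
  rfl

theorem sum_pow_smul_apply (U : H ≃ₗᵢ[ℂ] H) (z : ℂ) (v : H) (N : ℕ) :
    ∑ n ∈ Finset.range N, z ^ n • (U ^ (n : ℤ)) (v - z • U v) = v - z ^ N • (U ^ (N : ℤ)) v := by
  induction N with
  | zero => simp
  | succ N ih =>
    have h : (U ^ (N : ℤ)) (U v) = (U ^ ((N + 1 : ℕ) : ℤ)) v := by
      change (U ^ (N : ℤ) * U) v = _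
      rw [Nat.cast_succ, zpow_add_one]
    rw [Finset.sum_range_succ, ih, map_sub, map_smul, smul_sub, h, smul_smul, ← pow_succ]
    abel

/-- If the transfer function of `U` is the Schur function `E` of `μ`, then the powers of `U`
compress to the Fourier coefficients of `μ`. -/
theorem fourierCoeff_eq_compression {μ : OperatorMeasure 𝔐} (hμ : μ.toFun Set.univ = 1)
    (ι : 𝔐 →ₗᵢ[ℂ] H) (U : H ≃ₗᵢ[ℂ] H)
    (h : ∀ z ∈ Metric.ball (0 : ℂ) 1, ∀ x, ∃ v,
      adjoint ι.toContinuousLinearMap v = x ∧ v - z • U v = ι (x - z • μ.schurFun z x)) (n : ℤ) :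
    μ.fourierCoeff n = compression ι U n := by
  have key : ∀ z ∈ Metric.ball (0 : ℂ) 1, HasSum (fun n : ℕ => z ^ n • compression ι U n)
      ((2 : ℂ)⁻¹ • (μ.caratheodory z + 1)) := by
    intro z hz
    have hz1 := mem_ball_zero_iff.1 hz
    have hs : Summable fun n : ℕ => z ^ n • compression ι U n :=
      Summable.of_norm_bounded (summable_geometric_of_lt_one (norm_nonneg z) hz1) fun n => by
        rw [norm_smul, norm_pow]
        exact mul_le_of_le_one_right (by positivity) (norm_compression_le ι U n)
    have hu : IsUnit (1 - z • μ.schurFun z) := by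
      refine isUnit_one_sub_of_norm_lt ?_
      rw [norm_smul]
      have := (OperatorMeasure.isSchurClass_schurFun hμ).2 z hz
      nlinarith [norm_nonneg z, norm_nonneg (μ.schurFun z)]
    convert hs.hasSum using 1
    -- After multiplication by `I - z E(z)` it remains to sum the series on the vectors `x - z E(z)
    -- x`, where `ι (x - z E(z) x) = v - z U v` makes the partial sums telescope.
    refine hu.mul_right_cancel ?_
    rw [OperatorMeasure.caratheodory_mul_schurFun hμ hz]
    ext1 x
    obtain ⟨v, hv, hvU⟩ := h z hz x
    have h1 := (hs.hasSum.mapL (ContinuousLinearMap.apply ℂ 𝔐 (x - z • μ.schurFun z x))).tendsto_sum_nat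
    refine tendsto_nhds_unique ?_ h1
    have h2 : ∀ N : ℕ, ∑ n ∈ Finset.range N, (ContinuousLinearMap.apply ℂ 𝔐
        (x - z • μ.schurFun z x)) (z ^ n • compression ι U n) =
        x - adjoint ι.toContinuousLinearMap (z ^ N • (U ^ (N : ℤ)) v) := fun N => by
      rw [← hv, ← map_sub, ← sum_pow_smul_apply, map_sum, hv, hvU]
      simp [compression_apply]
    simp only [h2]
    have h3 : Filter.Tendsto (fun N : ℕ => adjoint ι.toContinuousLinearMap
        (z ^ N • (U ^ (N : ℤ)) v)) Filter.atTop (nhds 0) := by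
      refine squeeze_zero_norm (a := fun N => ‖z‖ ^ N * ‖v‖) (fun N => ?_) ?_
      · refine (norm_adjoint_isometry_apply_le ι _).trans ?_
        rw [norm_smul, norm_pow, LinearIsometryEquiv.norm_map]
      · simpa using (tendsto_pow_atTop_nhds_zero_of_lt_one (norm_nonneg z) hz1).mul_const ‖v‖
    simpa using h3.const_sub x
  have hnat : ∀ k : ℕ, μ.fourierCoeff k = compression ι U k := congrFun
    (hasSum_pow_smul_unique (fun z hz => OperatorMeasure.hasSum_fourierCoeff hμ hz) key)
  obtain ⟨k, rfl | rfl⟩ := n.eq_nat_or_neg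
  · exact hnat k
  · rw [OperatorMeasure.fourierCoeff_neg hμ, compression_neg, hnat]

theorem IsMinimalDilation.separableSpace [TopologicalSpace.SeparableSpace 𝔐] {ι : 𝔐 →ₗᵢ[ℂ] H}
    {U : H ≃ₗᵢ[ℂ] H} (h : IsMinimalDilation ι U) : TopologicalSpace.SeparableSpace H := by
  have hs : TopologicalSpace.IsSeparable {h : H | ∃ (n : ℤ) (x : 𝔐), h = (U ^ n) (ι x)} := by
    have : {h : H | ∃ (n : ℤ) (x : 𝔐), h = (U ^ n) (ι x)} =
        ⋃ n : ℤ, Set.range fun x => (U ^ n) (ι x) := by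
      ext h
      simp [eq_comm]
    rw [this]
    exact .iUnion fun n =>
      TopologicalSpace.isSeparable_range ((U ^ n).continuous.comp ι.continuous)
  have h1 := (hs.span (R := ℂ)).closure
  rw [← Submodule.topologicalClosure_coe, h] at h1
  exact TopologicalSpace.isSeparable_univ_iff.1 h1

/-- A closed subspace which contains `𝔐` and is invariant under `U` and `U⁻¹` is everything if
the dilation is minimal, and conversely. -/
theorem isMinimalDilation_of_forall {ι : 𝔐 →ₗᵢ[ℂ] H} {U : H ≃ₗᵢ[ℂ] H}
    (h : ∀ K : Submodule ℂ H, IsClosed (K : Set H) → (∀ x, ι x ∈ K) → (∀ v, U v ∈ K ↔ v ∈ K) →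
      K = ⊤) : IsMinimalDilation ι U := by
  set s : Set H := {h : H | ∃ (n : ℤ) (x : 𝔐), h = (U ^ n) (ι x)} with hs
  have hinv : ∀ V : H ≃ₗᵢ[ℂ] H, (∀ v ∈ s, V v ∈ s) →
      ∀ v ∈ (Submodule.span ℂ s).topologicalClosure, V v ∈ (Submodule.span ℂ s).topologicalClosure := by
    intro V hV
    have h1 : Set.MapsTo V (Submodule.span ℂ s : Set H) (Submodule.span ℂ s : Set H) := by
      intro v hv
      have h2 : Submodule.span ℂ s ≤ (Submodule.span ℂ s).comap V.toLinearEquiv.toLinearMap :=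
        Submodule.span_le.2 fun v hv => Submodule.subset_span (hV v hv)
      exact h2 hv
    exact fun v hv => h1.closure V.continuous hv
  refine h _ (Submodule.isClosed_topologicalClosure _) (fun x => ?_) fun v => ⟨fun hv => ?_, ?_⟩
  · exact Submodule.le_topologicalClosure _ (Submodule.subset_span ⟨0, x, by simp⟩)
  · have := hinv U⁻¹ (by
      rintro _ ⟨n, x, rfl⟩
      exact ⟨-1 + n, x, by rw [zpow_add, zpow_neg_one]; rfl⟩) _ hv
    simpa using this
  · refine hinv U ?_ v
    rintro _ ⟨n, x, rfl⟩
    exact ⟨1 + n, x, by rw [zpow_one_add]; rfl⟩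

theorem IsMinimalDilation.eq_top {ι : 𝔐 →ₗᵢ[ℂ] H} {U : H ≃ₗᵢ[ℂ] H} (h : IsMinimalDilation ι U)
    {K : Submodule ℂ H} (hK : IsClosed (K : Set H)) (hι : ∀ x, ι x ∈ K)
    (hU : ∀ v, U v ∈ K ↔ v ∈ K) : K = ⊤ := by
  have key : ∀ (n : ℤ) v, (U ^ n) v ∈ K ↔ v ∈ K := fun n => by
    induction n using Int.induction_on with
    | zero => intro v; rfl
    | succ n ih =>
      intro v
      rw [zpow_add_one]
      exact (ih (U v)).trans (hU v)
    | pred n ih =>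
      intro v
      rw [zpow_sub_one]
      refine (ih (U.symm v)).trans ?_
      rw [← hU, U.apply_symm_apply]
  rw [eq_top_iff, ← h]
  refine Submodule.topologicalClosure_minimal _ (Submodule.span_le.2 ?_) hK
  rintro _ ⟨n, x, rfl⟩
  exact (key n _).2 (hι x)

section Transfer

variable {ι : 𝔐 →ₗᵢ[ℂ] H} {U : H ≃ₗᵢ[ℂ] H} {ι' : 𝔐 →ₗᵢ[ℂ] H'} {U' : H' ≃ₗᵢ[ℂ] H'}

theorem IsMinimalDilation.transfer (h : IsMinimalDilation ι U) (W : H ≃ₗᵢ[ℂ] H')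
    (hU : ∀ h, W (U h) = U' (W h)) (hι : ∀ x, W (ι x) = ι' x) : IsMinimalDilation ι' U' := by
  refine isMinimalDilation_of_forall fun K hK hιK hUK => ?_
  have h1 := h.eq_top (K := K.comap W.toLinearEquiv.toLinearMap) (hK.preimage W.continuous)
    (fun x => by
      change W (ι x) ∈ K
      rw [hι]; exact hιK x)
    fun v => by
      change W (U v) ∈ K ↔ W v ∈ K
      rw [hU, hUK]
  rw [eq_top_iff]
  intro v _
  have h2 : W.symm v ∈ K.comap W.toLinearEquiv.toLinearMap := h1 ▸ Submodule.mem_top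
  change W (W.symm v) ∈ K at h2
  rwa [W.apply_symm_apply] at h2

theorem compression_eq_of_intertwine (W : H ≃ₗᵢ[ℂ] H') (hU : ∀ h, W (U h) = U' (W h))
    (hι : ∀ x, W (ι x) = ι' x) (n : ℤ) : compression ι' U' n = compression ι U n := by
  have key : ∀ (n : ℤ) v, W ((U ^ n) v) = (U' ^ n) (W v) := fun n => by
    induction n using Int.induction_on with
    | zero => intro v; rfl
    | succ n ih =>
      intro v
      rw [zpow_add_one, zpow_add_one]
      exact (ih (U v)).trans (congrArg _ (hU v))
    | pred n ih =>
      intro v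
      rw [zpow_sub_one, zpow_sub_one]
      refine (ih (U.symm v)).trans (congrArg _ ?_)
      change _ = U'.symm (W v)
      rw [LinearIsometryEquiv.eq_symm_apply, ← hU, U.apply_symm_apply]
  refine ContinuousLinearMap.ext fun x => ext_inner_right ℂ fun y => ?_
  rw [compression_apply, compression_apply, adjoint_inner_left, adjoint_inner_left,
    LinearIsometry.coe_toContinuousLinearMap, LinearIsometry.coe_toContinuousLinearMap, ← hι, ← hι,
    ← key, W.inner_map_map]

end Transfer

end Dilation

/-! ### Single-block vectors and how regrouping moves them. -/

section Blocks

variable {G : Type*} {A B : ℕ → Type*} [NormedAddCommGroup G] [InnerProductSpace ℂ G]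
  [∀ n, NormedAddCommGroup (A n)] [∀ n, InnerProductSpace ℂ (A n)]
  [∀ n, NormedAddCommGroup (B n)] [∀ n, InnerProductSpace ℂ (B n)]

theorem lp_single_ext {E : ℕ → Type*} [∀ n, NormedAddCommGroup (E n)] {n : ℕ} {v : E n}
    {f : lp E 2} (h : f n = v) (h0 : ∀ m, m ≠ n → f m = 0) : f = lp.single 2 n v := by
  refine lp.ext (funext fun m => ?_)
  rcases eq_or_ne m n with rfl | hm
  · rw [h, lp.single_apply_self]
  · rw [h0 m hm, lp.single_apply_ne _ _ _ hm]

theorem blockDiag_single {E F : ℕ → Type*} [∀ n, NormedAddCommGroup (E n)]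
    [∀ n, InnerProductSpace ℂ (E n)] [∀ n, NormedAddCommGroup (F n)]
    [∀ n, InnerProductSpace ℂ (F n)] (e : ∀ n, E n ≃ₗᵢ[ℂ] F n) (n : ℕ) (v : E n) :
    blockDiag e (lp.single 2 n v) = lp.single 2 n (e n v) := by
  refine lp_single_ext ?_ fun m hm => ?_
  · change e n (lp.single 2 n v n) = _
    rw [lp.single_apply_self]
  · change e m (lp.single 2 n v m) = 0
    rw [lp.single_apply_ne _ _ _ hm, map_zero]

/-- The vector of `G ⊕ A₀ ⊕ A₁ ⊕ ⋯` with the single block `v` in `Aₙ`. -/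
def blockVec (G : Type*) {E : ℕ → Type*} [NormedAddCommGroup G]
    [∀ n, NormedAddCommGroup (E n)] (n : ℕ) (v : E n) : WithLp 2 (G × lp E 2) :=
  WithLp.toLp 2 (0, lp.single 2 n v)

theorem blockVec_add {E : ℕ → Type*} [∀ n, NormedAddCommGroup (E n)] (n : ℕ) (v w : E n) :
    blockVec G n (v + w) = blockVec G n v + blockVec G n w := by
  apply WithLp.ofLp_injective 2
  refine Prod.ext (add_zero (0 : G)).symm ?_
  exact lp.single_add 2 n v w

theorem continuous_blockVec {E : ℕ → Type*} [∀ n, NormedAddCommGroup (E n)] (n : ℕ) :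
    Continuous (blockVec G n : E n → WithLp 2 (G × lp E 2)) :=
  (WithLp.prod_continuous_toLp 2 G (lp E 2)).comp
    (continuous_const.prodMk (lp.isometry_single (p := 2) n).continuous)

theorem mem_of_blockVec_mem {E : ℕ → Type*} [∀ n, NormedAddCommGroup (E n)]
    [∀ n, InnerProductSpace ℂ (E n)] {K : Submodule ℂ (WithLp 2 (G × lp E 2))}
    (hK : IsClosed (K : Set (WithLp 2 (G × lp E 2)))) (h0 : ∀ x, WithLp.toLp 2 (x, 0) ∈ K)
    (h : ∀ n v, blockVec G n v ∈ K) (u : WithLp 2 (G × lp E 2)) : u ∈ K := by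
  have e : u = WithLp.toLp 2 (u.fst, 0) + WithLp.toLp 2 (0, u.snd) := by
    apply WithLp.ofLp_injective 2
    exact Prod.ext (add_zero _).symm (zero_add _).symm
  rw [e]
  refine K.add_mem (h0 _) ?_
  have hs := (lp.hasSum_single (p := 2) (by norm_num) u.snd).tendsto_sum_nat
  have hc : Continuous fun f : lp E 2 => (WithLp.toLp 2 ((0 : G), f) : WithLp 2 (G × lp E 2)) :=
    (WithLp.prod_continuous_toLp 2 G (lp E 2)).comp (continuous_const.prodMk continuous_id)
  refine hK.mem_of_tendsto ((hc.tendsto _).comp hs) (.of_forall fun N => ?_)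
  have key : ∀ N, (WithLp.toLp 2 ((0 : G), ∑ n ∈ Finset.range N, lp.single 2 n (u.snd n)) :
      WithLp 2 (G × lp E 2)) ∈ K := fun N => by
    induction N with
    | zero => rw [Finset.sum_range_zero]; exact K.zero_mem
    | succ N ih =>
      rw [Finset.sum_range_succ]
      have e2 : (WithLp.toLp 2 ((0 : G), ∑ n ∈ Finset.range N, lp.single 2 n (u.snd n) +
          lp.single 2 N (u.snd N)) : WithLp 2 (G × lp E 2)) =
          WithLp.toLp 2 (0, ∑ n ∈ Finset.range N, lp.single 2 n (u.snd n)) +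
            blockVec G N (u.snd N) := by
        apply WithLp.ofLp_injective 2
        exact Prod.ext (add_zero _).symm rfl
      rw [e2]
      exact K.add_mem ih (h N _)
  exact key N

theorem regroup_left (x : G) : regroup G A B (WithLp.toLp 2 (x, 0)) =
    WithLp.toLp 2 (WithLp.toLp 2 (x, 0), 0) := rfl

theorem regroup_blockVec_zero_fst (a : A 0) :
    regroup G A B (blockVec G 0 (WithLp.toLp 2 (a, 0))) =
      WithLp.toLp 2 (WithLp.toLp 2 (0, a), 0) := by
  apply WithLp.ofLp_injective 2
  refine Prod.ext (WithLp.ofLp_injective 2 (Prod.ext rfl ?_)) (lp.ext (funext fun m =>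
    WithLp.ofLp_injective 2 (Prod.ext ?_ ?_)))
  · change (lp.single (E := fun k => WithLp 2 (A k × B k)) 2 0 (WithLp.toLp 2 (a, 0)) 0).fst = a
    rw [lp.single_apply_self]; rfl
  · change (lp.single (E := fun k => WithLp 2 (A k × B k)) 2 0 (WithLp.toLp 2 (a, 0)) m).snd = 0
    rcases eq_or_ne m 0 with rfl | hm
    · rw [lp.single_apply_self]; rfl
    · rw [lp.single_apply_ne _ _ _ hm]; rfl
  · change (lp.single (E := fun k => WithLp 2 (A k × B k)) 2 0 (WithLp.toLp 2 (a, 0)) (m + 1)).fst = 0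
    rw [lp.single_apply_ne _ _ _ m.succ_ne_zero]; rfl

theorem regroup_blockVec_snd (n : ℕ) (b : B n) :
    regroup G A B (blockVec G n (WithLp.toLp 2 (0, b))) =
      blockVec (WithLp 2 (G × A 0)) (E := fun n => WithLp 2 (B n × A (n + 1))) n
        (WithLp.toLp 2 (b, 0)) := by
  have hfst : ∀ m, (lp.single (E := fun k => WithLp 2 (A k × B k)) 2 n
      (WithLp.toLp 2 (0, b)) m).fst = 0 :=
    fun m => by
      rcases eq_or_ne m n with rfl | hm
      · rw [lp.single_apply_self]; rfl
      · rw [lp.single_apply_ne _ _ _ hm]; rfl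
  apply WithLp.ofLp_injective 2
  refine Prod.ext (WithLp.ofLp_injective 2 (Prod.ext rfl (hfst 0))) (lp_single_ext ?_ fun m hm => ?_)
  · refine WithLp.ofLp_injective 2 (Prod.ext ?_ (hfst (n + 1)))
    change (lp.single (E := fun k => WithLp 2 (A k × B k)) 2 n (WithLp.toLp 2 (0, b)) n).snd = b
    rw [lp.single_apply_self]; rfl
  · refine WithLp.ofLp_injective 2 (Prod.ext ?_ (hfst (m + 1)))
    change (lp.single (E := fun k => WithLp 2 (A k × B k)) 2 n (WithLp.toLp 2 (0, b)) m).snd = 0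
    rw [lp.single_apply_ne _ _ _ hm]; rfl

/-- Regrouping lowers the position of `Aₙ₊₁` by one, pairing it with `Bₙ`; `A₀` joins `G`, and each
`Bₙ` keeps its position. -/
theorem regroup_blockVec_succ_fst (n : ℕ) (a : A (n + 1)) :
    regroup G A B (blockVec G (n + 1) (WithLp.toLp 2 (a, 0))) =
      blockVec (WithLp 2 (G × A 0)) (E := fun n => WithLp 2 (B n × A (n + 1))) n
        (WithLp.toLp 2 (0, a)) := by
  have hsnd : ∀ m, (lp.single (E := fun k => WithLp 2 (A k × B k)) 2 (n + 1)
      (WithLp.toLp 2 (a, 0)) m).snd = 0 :=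
    fun m => by
      rcases eq_or_ne m (n + 1) with rfl | hm
      · rw [lp.single_apply_self]; rfl
      · rw [lp.single_apply_ne _ _ _ hm]; rfl
  apply WithLp.ofLp_injective 2
  refine Prod.ext (WithLp.ofLp_injective 2 (Prod.ext rfl ?_)) (lp_single_ext ?_ fun m hm => ?_)
  · change (lp.single (E := fun k => WithLp 2 (A k × B k)) 2 (n + 1) (WithLp.toLp 2 (a, 0)) 0).fst = 0
    rw [lp.single_apply_ne _ _ _ n.succ_ne_zero.symm]; rfl
  · refine WithLp.ofLp_injective 2 (Prod.ext (hsnd n) ?_)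
    change (lp.single (E := fun k => WithLp 2 (A k × B k)) 2 (n + 1) (WithLp.toLp 2 (a, 0)) (n + 1)).fst = a
    rw [lp.single_apply_self]; rfl
  · refine WithLp.ofLp_injective 2 (Prod.ext (hsnd m) ?_)
    change (lp.single (E := fun k => WithLp 2 (A k × B k)) 2 (n + 1) (WithLp.toLp 2 (a, 0)) (m + 1)).fst = 0
    rw [lp.single_apply_ne _ _ _ fun h => hm (Nat.succ_injective h)]; rfl

end Blocks

/-! ### Dense corners of a rotation. -/

section Rotation

variable {X Y : Type*} [NormedAddCommGroup X] [InnerProductSpace ℂ X] [CompleteSpace X]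
  [NormedAddCommGroup Y] [InnerProductSpace ℂ Y] [CompleteSpace Y]

theorem rotation_apply_left (T : X →L[ℂ] Y) (hT : ‖T‖ ≤ 1) (x : X) :
    rotation T hT (WithLp.toLp 2 (x, 0)) = WithLp.toLp 2 (T x, defectMap T x) := by
  change rotationLin T hT _ = _
  apply WithLp.ofLp_injective 2
  simp [rotationLin]

theorem rotation_apply_adjoint (T : X →L[ℂ] Y) (hT : ‖T‖ ≤ 1) (y : Y) :
    rotation T hT (WithLp.toLp 2 (adjoint T y, defectMap (adjoint T) y)) =
      WithLp.toLp 2 (y, 0) := by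
  rw [← LinearIsometryEquiv.eq_symm_apply]
  change _ = rotationInvLin T hT _
  apply WithLp.ofLp_injective 2
  simp [rotationInvLin]

/-- Each of the two rows and columns of a rotation that meet in the corner block has dense range
in the defect space. -/
theorem rotation_exists_dense (T : X →L[ℂ] Y) (hT : ‖T‖ ≤ 1) :
    (∃ (p : X → Y) (q : X → defectSpace T), DenseRange q ∧
      ∀ x, rotation T hT (WithLp.toLp 2 (x, 0)) = WithLp.toLp 2 (p x, q x)) ∧
    ∃ (p : Y → X) (q : Y → defectSpace (adjoint T)), DenseRange q ∧
      ∀ y, rotation T hT (WithLp.toLp 2 (p y, q y)) = WithLp.toLp 2 (y, 0) :=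
  ⟨⟨T, defectMap T, denseRange_defectMap T, rotation_apply_left T hT⟩,
    ⟨adjoint T, defectMap (adjoint T), denseRange_defectMap _, rotation_apply_adjoint T hT⟩⟩

end Rotation

theorem toLp_eq_add {P Q : Type*} [NormedAddCommGroup P] [NormedAddCommGroup Q] (p : P) (q : Q) :
    (WithLp.toLp 2 (p, q) : WithLp 2 (P × Q)) = WithLp.toLp 2 (p, 0) + WithLp.toLp 2 (0, q) := by
  apply WithLp.ofLp_injective 2
  exact Prod.ext (add_zero _).symm (zero_add _).symm

/-! ### Block-by-block action of `M₀` and `L₀`, and minimality. -/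

namespace SchurFunction

variable (S : SchurFunction)

theorem rotZero_exists_dense :
    (∃ (p : S.X → S.Y) (q : S.X → S.D (2 * 0)), DenseRange q ∧
      ∀ x, S.rotZero (WithLp.toLp 2 (x, 0)) = WithLp.toLp 2 (p x, q x)) ∧
    ∃ (p : S.Y → S.X) (q : S.Y → S.Dstar (2 * 0)), DenseRange q ∧
      ∀ y, S.rotZero (WithLp.toLp 2 (p y, q y)) = WithLp.toLp 2 (y, 0) :=
  rotation_exists_dense (S.param 0) (S.norm_param_le 0)

theorem rotSucc_exists_dense (n : ℕ) :
    (∃ (p : S.D n → S.Dstar n) (q : S.D n → S.D (n + 1)), DenseRange q ∧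
      ∀ x, S.rotSucc n (WithLp.toLp 2 (x, 0)) = WithLp.toLp 2 (p x, q x)) ∧
    ∃ (p : S.Dstar n → S.D n) (q : S.Dstar n → S.Dstar (n + 1)), DenseRange q ∧
      ∀ y, S.rotSucc n (WithLp.toLp 2 (p y, q y)) = WithLp.toLp 2 (y, 0) :=
  rotation_exists_dense (S.param (n + 1)) (S.norm_param_le (n + 1))

theorem M₀_left (x : S.X) : S.M₀ (WithLp.toLp 2 (x, 0)) = WithLp.toLp 2 (x, 0) := by
  apply WithLp.ofLp_injective 2
  exact Prod.ext rfl (map_zero S.V₀)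

theorem M₀_blockVec (n : ℕ) (v : WithLp 2 (S.D (2 * n) × S.Dstar (2 * n + 1))) :
    S.M₀ (blockVec S.X n v) = blockVec S.X n (S.rotSucc (2 * n) v) := by
  apply WithLp.ofLp_injective 2
  exact Prod.ext rfl (blockDiag_single (fun n => S.rotSucc (2 * n)) n v)

theorem evenDiag_left (v : WithLp 2 (S.X × S.Dstar (2 * 0))) :
    S.evenDiag (WithLp.toLp 2 (v, 0)) = WithLp.toLp 2 (S.rotZero v, 0) := by
  apply WithLp.ofLp_injective 2
  exact Prod.ext rfl (map_zero (blockDiag S.rotEven))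

theorem evenDiag_blockVec (n : ℕ) (v : WithLp 2 (S.D (2 * n + 1) × S.Dstar (2 * (n + 1)))) :
    S.evenDiag (blockVec _ n v) = blockVec _ n (S.rotEven n v) := by
  apply WithLp.ofLp_injective 2
  exact Prod.ext (map_zero S.rotZero) (blockDiag_single S.rotEven n v)

theorem L₀_eq_iff (v : WithLp 2 (S.X × S.Ht₀)) (u : WithLp 2 (S.Y × S.H₀)) :
    S.L₀ v = u ↔ S.evenDiag (regroup S.X (fun n => S.Dstar (2 * n)) (fun n => S.D (2 * n + 1)) v) =
      regroup S.Y (fun n => S.D (2 * n)) (fun n => S.Dstar (2 * n + 1)) u :=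
  (regroup S.Y (fun n => S.D (2 * n)) (fun n => S.Dstar (2 * n + 1))).symm_apply_eq

/-- How `L₀` acts on the blocks `X` and `𝔇_{Γ₀*}`. -/
theorem L₀_apply_zero {x : S.X} {c : S.Dstar (2 * 0)} {y : S.Y} {a : S.D (2 * 0)}
    (h : S.rotZero (WithLp.toLp 2 (x, c)) = WithLp.toLp 2 (y, a)) :
    S.L₀ (WithLp.toLp 2 (x, 0) + blockVec S.X 0 (WithLp.toLp 2 (c, 0))) =
      WithLp.toLp 2 (y, 0) + blockVec S.Y 0 (WithLp.toLp 2 (a, 0)) := by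
  rw [L₀_eq_iff, map_add, map_add, map_add, regroup_left, regroup_left,
    regroup_blockVec_zero_fst (A := fun n => S.Dstar (2 * n)) (B := fun n => S.D (2 * n + 1)),
    regroup_blockVec_zero_fst (A := fun n => S.D (2 * n)) (B := fun n => S.Dstar (2 * n + 1)),
    evenDiag_left, evenDiag_left]
  have h' := h
  rw [toLp_eq_add x c, toLp_eq_add y a, map_add] at h'
  apply WithLp.ofLp_injective 2
  exact Prod.ext h' rfl

/-- How `L₀` acts on the blocks `𝔇_{Γ₂ₙ₊₁}` and `𝔇_{Γ₂ₙ₊₂*}`. -/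
theorem L₀_apply_succ {n : ℕ} {d : S.D (2 * n + 1)} {c : S.Dstar (2 * (n + 1))}
    {b : S.Dstar (2 * n + 1)} {a : S.D (2 * (n + 1))}
    (h : S.rotEven n (WithLp.toLp 2 (d, c)) = WithLp.toLp 2 (b, a)) :
    S.L₀ (blockVec S.X n (WithLp.toLp 2 (0, d)) +
        blockVec S.X (n + 1) (WithLp.toLp 2 (c, 0))) =
      blockVec S.Y n (WithLp.toLp 2 (0, b)) + blockVec S.Y (n + 1) (WithLp.toLp 2 (a, 0)) := by
  rw [L₀_eq_iff, map_add, map_add, map_add,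
    regroup_blockVec_snd (A := fun n => S.Dstar (2 * n)) (B := fun n => S.D (2 * n + 1)),
    regroup_blockVec_snd (A := fun n => S.D (2 * n)) (B := fun n => S.Dstar (2 * n + 1)),
    regroup_blockVec_succ_fst (A := fun n => S.Dstar (2 * n)) (B := fun n => S.D (2 * n + 1)),
    regroup_blockVec_succ_fst (A := fun n => S.D (2 * n)) (B := fun n => S.Dstar (2 * n + 1)),
    ← map_add S.evenDiag, ← blockVec_add, ← blockVec_add, ← toLp_eq_add, ← toLp_eq_add, evenDiag_blockVec, h]

/-- Subspaces which are matched by `M₀` and `L₀` and contain `X` and `Y` contain all blocks. -/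
theorem blockVec_mem {K₁ : Submodule ℂ (WithLp 2 (S.X × S.H₀))}
    {K₂ : Submodule ℂ (WithLp 2 (S.Y × S.H₀))} {Kt : Submodule ℂ (WithLp 2 (S.X × S.Ht₀))}
    (hc₂ : IsClosed (K₂ : Set (WithLp 2 (S.Y × S.H₀))))
    (hct : IsClosed (Kt : Set (WithLp 2 (S.X × S.Ht₀))))
    (hM : ∀ v, S.M₀ v ∈ Kt ↔ v ∈ K₁) (hL : ∀ v, S.L₀ v ∈ K₂ ↔ v ∈ Kt)
    (hX : ∀ x, WithLp.toLp 2 (x, 0) ∈ K₁) (hY : ∀ y, WithLp.toLp 2 (y, 0) ∈ K₂)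
    (h12 : ∀ h, WithLp.toLp 2 (0, h) ∈ K₁ ↔ WithLp.toLp 2 (0, h) ∈ K₂) (n : ℕ)
    (v : WithLp 2 (S.D (2 * n) × S.Dstar (2 * n + 1))) : blockVec S.Y n v ∈ K₂ := by
  have hXt : ∀ x, WithLp.toLp 2 (x, 0) ∈ Kt := fun x => by
    rw [← S.M₀_left, hM]; exact hX x
  have h12' : ∀ n v, blockVec S.X n v ∈ K₁ ↔ blockVec S.Y n v ∈ K₂ := fun n v => h12 _
  -- Each rotation yields two blocks. Its first row, through `J (T* y, D_{T*} y) = (y, 0)`, puts the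
  -- vectors `D_{T*} y` in the source subspace; its first column, through `J (x, 0) = (T x, D_T x)`,
  -- puts the vectors `D_T x` in the target. The other component is already known to lie there, and
  -- density with closedness gives the whole block.
  have hodd : ∀ n, (∀ a, blockVec S.Y n (WithLp.toLp 2 (a, 0)) ∈ K₂) →
      (∀ c, blockVec S.X n (WithLp.toLp 2 (c, 0)) ∈ Kt) →
      (∀ b, blockVec S.Y n (WithLp.toLp 2 (0, b)) ∈ K₂) ∧
      ∀ d, blockVec S.X n (WithLp.toLp 2 (0, d)) ∈ Kt := by
    intro n ha hc
    obtain ⟨⟨p, q, hq, h⟩, ⟨p', q', hq', h'⟩⟩ := S.rotSucc_exists_dense (2 * n)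
    constructor
    · intro b
      refine hq'.induction_on b (hc₂.preimage ((continuous_blockVec n).comp
        ((WithLp.prod_continuous_toLp 2 _ _).comp (continuous_const.prodMk continuous_id))))
        fun c => ?_
      have h1 : blockVec S.X n (WithLp.toLp 2 (p' c, q' c)) ∈ K₁ := by
        rw [← hM, M₀_blockVec, h']; exact hc c
      rw [h12', toLp_eq_add, blockVec_add] at h1
      exact (K₂.add_mem_iff_right (ha _)).1 h1
    · intro d
      refine hq.induction_on d (hct.preimage ((continuous_blockVec n).comp
        ((WithLp.prod_continuous_toLp 2 _ _).comp (continuous_const.prodMk continuous_id))))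
        fun a => ?_
      have h1 := (hM _).2 ((h12' n _).2 (ha a))
      rw [M₀_blockVec, h, toLp_eq_add, blockVec_add] at h1
      exact (Kt.add_mem_iff_right (hc _)).1 h1
  have heven : ∀ n, (∀ a, blockVec S.Y n (WithLp.toLp 2 (a, 0)) ∈ K₂) ∧
      ∀ c, blockVec S.X n (WithLp.toLp 2 (c, 0)) ∈ Kt := by
    intro n
    induction n with
    | zero =>
      obtain ⟨⟨p, q, hq, h⟩, ⟨p', q', hq', h'⟩⟩ := S.rotZero_exists_dense
      constructor
      · intro a
        refine hq.induction_on a (hc₂.preimage ((continuous_blockVec 0).comp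
          ((WithLp.prod_continuous_toLp 2 _ _).comp (continuous_id.prodMk continuous_const))))
          fun x => ?_
        have h1 := S.L₀_apply_zero (h x)
        have h2 : blockVec S.X (E := fun n => WithLp 2 (S.Dstar (2 * n) × S.D (2 * n + 1))) 0
            (WithLp.toLp 2 (0, 0)) = 0 := by
          apply WithLp.ofLp_injective 2
          exact Prod.ext rfl (lp.single_zero 2 0)
        rw [h2, add_zero] at h1
        have h3 := (hL _).2 (hXt x)
        rw [h1] at h3
        exact (K₂.add_mem_iff_right (hY _)).1 h3
      · intro c
        refine hq'.induction_on c (hct.preimage ((continuous_blockVec 0).comp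
          ((WithLp.prod_continuous_toLp 2 _ _).comp (continuous_id.prodMk continuous_const))))
          fun y => ?_
        have h1 := S.L₀_apply_zero (h' y)
        have h2 : blockVec S.Y (E := fun n => WithLp 2 (S.D (2 * n) × S.Dstar (2 * n + 1))) 0
            (WithLp.toLp 2 (0, 0)) = 0 := by
          apply WithLp.ofLp_injective 2
          exact Prod.ext rfl (lp.single_zero 2 0)
        rw [h2, add_zero] at h1
        have h3 := hY y
        rw [← h1, hL] at h3
        exact (Kt.add_mem_iff_right (hXt _)).1 h3
    | succ n ih =>
      obtain ⟨hb, hd⟩ := hodd n ih.1 ih.2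
      obtain ⟨⟨p, q, hq, h⟩, ⟨p', q', hq', h'⟩⟩ := S.rotSucc_exists_dense (2 * n + 1)
      constructor
      · intro a
        refine hq.induction_on a (hc₂.preimage ((continuous_blockVec (n + 1)).comp
          ((WithLp.prod_continuous_toLp 2 _ _).comp (continuous_id.prodMk continuous_const))))
          fun d => ?_
        have h1 := S.L₀_apply_succ (h d)
        have h2 : blockVec S.X (E := fun n => WithLp 2 (S.Dstar (2 * n) × S.D (2 * n + 1))) (n + 1)
            (WithLp.toLp 2 (0, 0)) = 0 := by
          apply WithLp.ofLp_injective 2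
          exact Prod.ext rfl (lp.single_zero 2 _)
        rw [h2, add_zero] at h1
        have h3 := (hL _).2 (hd d)
        rw [h1] at h3
        exact (K₂.add_mem_iff_right (hb _)).1 h3
      · intro c
        refine hq'.induction_on c (hct.preimage ((continuous_blockVec (n + 1)).comp
          ((WithLp.prod_continuous_toLp 2 _ _).comp (continuous_id.prodMk continuous_const))))
          fun b => ?_
        have h1 := S.L₀_apply_succ (h' b)
        have h2 : blockVec S.Y (E := fun n => WithLp 2 (S.D (2 * n) × S.Dstar (2 * n + 1))) (n + 1)
            (WithLp.toLp 2 (0, 0)) = 0 := by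
          apply WithLp.ofLp_injective 2
          exact Prod.ext rfl (lp.single_zero 2 _)
        rw [h2, add_zero] at h1
        have h3 := hb b
        rw [← h1, hL] at h3
        exact (Kt.add_mem_iff_right (hd _)).1 h3
  rw [show v = WithLp.toLp 2 (v.fst, v.snd) from rfl, toLp_eq_add, blockVec_add]
  exact K₂.add_mem ((heven n).1 _) ((hodd n (heven n).1 (heven n).2).1 _)

/-- Subspaces which are matched by `U₀` and contain `X` and `Y` contain everything. -/
theorem mem_of_U₀_mem_iff {K₁ : Submodule ℂ (WithLp 2 (S.X × S.H₀))}
    {K₂ : Submodule ℂ (WithLp 2 (S.Y × S.H₀))}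
    (hc₁ : IsClosed (K₁ : Set (WithLp 2 (S.X × S.H₀))))
    (hc₂ : IsClosed (K₂ : Set (WithLp 2 (S.Y × S.H₀))))
    (hU : ∀ v, S.U₀ v ∈ K₂ ↔ v ∈ K₁)
    (hX : ∀ x, WithLp.toLp 2 (x, 0) ∈ K₁) (hY : ∀ y, WithLp.toLp 2 (y, 0) ∈ K₂)
    (h12 : ∀ h, WithLp.toLp 2 (0, h) ∈ K₁ ↔ WithLp.toLp 2 (0, h) ∈ K₂)
    (u : WithLp 2 (S.Y × S.H₀)) : u ∈ K₂ := by
  -- The intermediate subspace is `M₀ K₁`, written as a preimage under `M₀⁻¹` so that it is visibly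
  -- closed.
  have hM : ∀ v, S.M₀ v ∈ K₁.comap S.M₀.symm.toLinearEquiv.toLinearMap ↔ v ∈ K₁ := fun v =>
    Submodule.mem_comap.trans (by
      rw [show S.M₀.symm.toLinearEquiv.toLinearMap (S.M₀ v) = v from S.M₀.symm_apply_apply v])
  have hL : ∀ v, S.L₀ v ∈ K₂ ↔ v ∈ K₁.comap S.M₀.symm.toLinearEquiv.toLinearMap := fun v => by
    have h := hU (S.M₀.symm v)
    rw [show S.U₀ (S.M₀.symm v) = S.L₀ v from congrArg S.L₀ (S.M₀.apply_symm_apply v)] at h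
    exact h
  exact mem_of_blockVec_mem hc₂ hY
    (S.blockVec_mem hc₂ (hc₁.preimage S.M₀.symm.continuous) hM hL hX hY h12) u

end SchurFunction

/-! ### The two CMV dilations and their equivalence. -/

section Main

variable {𝔐 : Type*} [NormedAddCommGroup 𝔐] [InnerProductSpace ℂ 𝔐] [CompleteSpace 𝔐]

theorem isMinimalDilation_cmv (Θ : ℂ → 𝔐 →L[ℂ] 𝔐) (hΘ : IsSchurClass Θ) :
    IsMinimalDilation (inclLeft 𝔐 (SchurFunction.mk 𝔐 𝔐 Θ hΘ).H₀) (cmv Θ hΘ) :=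
  isMinimalDilation_of_forall fun K hK hιK hUK => eq_top_iff.2 fun u _ =>
    (SchurFunction.mk 𝔐 𝔐 Θ hΘ).mem_of_U₀_mem_iff (K₁ := K) (K₂ := K) hK hK hUK hιK hιK
      (fun _ => Iff.rfl) u

theorem adjoint_inclLeft_apply {K : Type*} [NormedAddCommGroup K] [InnerProductSpace ℂ K]
    [CompleteSpace K] (v : WithLp 2 (𝔐 × K)) :
    adjoint (inclLeft 𝔐 K).toContinuousLinearMap v = v.fst := by
  refine ext_inner_left ℂ fun y => ?_
  rw [adjoint_inner_right]
  simp [inclLeft]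

theorem fourierCoeff_eq_compression_cmv {μ : OperatorMeasure 𝔐} (hμ : μ.toFun Set.univ = 1)
    (hE : IsSchurClass μ.schurFun) (n : ℤ) :
    μ.fourierCoeff n = compression (inclLeft 𝔐 (SchurFunction.mk 𝔐 𝔐 μ.schurFun hE).H₀)
      (cmv μ.schurFun hE) n := by
  refine fourierCoeff_eq_compression hμ _ _ (fun z hz x => ?_) n
  obtain ⟨k, hk⟩ := (SchurFunction.mk 𝔐 𝔐 μ.schurFun hE).exists_U₀_eq hz x
  refine ⟨WithLp.toLp 2 (x, z • k), adjoint_inclLeft_apply _, ?_⟩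
  refine (congrArg (fun u => WithLp.toLp 2 (x, z • k) - z • u) hk).trans ?_
  apply WithLp.ofLp_injective 2
  exact Prod.ext rfl (sub_self (z • k))

/-- Both sides are `M₀ L₀ M₀ h`; since input and output spaces coincide, `Mt₀` is `M₀`. -/
theorem M₀_cmv (Θ : ℂ → 𝔐 →L[ℂ] 𝔐) (hΘ : IsSchurClass Θ)
    (h : WithLp 2 (𝔐 × (SchurFunction.mk 𝔐 𝔐 Θ hΘ).H₀)) :
    (SchurFunction.mk 𝔐 𝔐 Θ hΘ).M₀ (cmv Θ hΘ h) =
      cmvt Θ hΘ ((SchurFunction.mk 𝔐 𝔐 Θ hΘ).M₀ h) := rfl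

theorem M₀_inclLeft (Θ : ℂ → 𝔐 →L[ℂ] 𝔐) (hΘ : IsSchurClass Θ) (x : 𝔐) :
    (SchurFunction.mk 𝔐 𝔐 Θ hΘ).M₀ (inclLeft 𝔐 (SchurFunction.mk 𝔐 𝔐 Θ hΘ).H₀ x) =
      inclLeft 𝔐 (SchurFunction.mk 𝔐 𝔐 Θ hΘ).Ht₀ x :=
  (SchurFunction.mk 𝔐 𝔐 Θ hΘ).M₀_left x

theorem isMinimalDilation_cmvt (Θ : ℂ → 𝔐 →L[ℂ] 𝔐) (hΘ : IsSchurClass Θ) :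
    IsMinimalDilation (inclLeft 𝔐 (SchurFunction.mk 𝔐 𝔐 Θ hΘ).Ht₀) (cmvt Θ hΘ) :=
  (isMinimalDilation_cmv Θ hΘ).transfer _ (M₀_cmv Θ hΘ) (M₀_inclLeft Θ hΘ)

variable [TopologicalSpace.SeparableSpace 𝔐] {μ : OperatorMeasure 𝔐}

theorem isNaimarkDilation_cmv (hμ : μ.toFun Set.univ = 1) (hE : IsSchurClass μ.schurFun) :
    IsNaimarkDilation μ (inclLeft 𝔐 (SchurFunction.mk 𝔐 𝔐 μ.schurFun hE).H₀)
      (cmv μ.schurFun hE) where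
  separable := (isMinimalDilation_cmv μ.schurFun hE).separableSpace
  fourierCoeff_eq n x := by
    rw [fourierCoeff_eq_compression_cmv hμ hE, compression_apply]

theorem isNaimarkDilation_cmvt (hμ : μ.toFun Set.univ = 1) (hE : IsSchurClass μ.schurFun) :
    IsNaimarkDilation μ (inclLeft 𝔐 (SchurFunction.mk 𝔐 𝔐 μ.schurFun hE).Ht₀)
      (cmvt μ.schurFun hE) where
  separable := (isMinimalDilation_cmvt μ.schurFun hE).separableSpace
  fourierCoeff_eq n x := by
    rw [fourierCoeff_eq_compression_cmv hμ hE,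
      ← compression_eq_of_intertwine _ (M₀_cmv μ.schurFun hE) (M₀_inclLeft μ.schurFun hE),
      compression_apply]

end Main

end BlockCMV

end

theorem theorem6p9 {𝔐 : Type*} [NormedAddCommGroup 𝔐] [InnerProductSpace ℂ 𝔐] [CompleteSpace 𝔐]
    [TopologicalSpace.SeparableSpace 𝔐]
    (μ : BlockCMV.OperatorMeasure 𝔐) (hμ : μ.toFun Set.univ = 1) :
    -- the integrals that define the Fourier coefficients and `F` exist, and `F(z) + I` is invertible
    (∀ n : ℤ, μ.HasIntegral (fun ξ => (ξ : ℂ) ^ (-n)) (μ.fourierCoeff n)) ∧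
    (∀ z ∈ Metric.ball (0 : ℂ) 1,
      μ.HasIntegral (fun ξ => ((ξ : ℂ) + z) / ((ξ : ℂ) - z)) (μ.caratheodory z) ∧
      IsUnit (μ.caratheodory z + 1)) ∧
    -- `E` belongs to the Schur class
    ∃ hE : BlockCMV.IsSchurClass μ.schurFun,
      let S : BlockCMV.SchurFunction := BlockCMV.SchurFunction.mk 𝔐 𝔐 μ.schurFun hE
      -- the Schur algorithm for `E` never fails, and its result is unique
      (∀ n : ℕ,
        BlockCMV.IsSchurIterate (S.iterate n).toFun (S.iterate n).isSchur
          (S.iterate (n + 1)).toFun ∧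
        ∀ Θ', BlockCMV.IsSchurIterate (S.iterate n).toFun (S.iterate n).isSchur Θ' →
          Set.EqOn Θ' (S.iterate (n + 1)).toFun (Metric.ball 0 1)) ∧
      -- both pairs are minimal Naimark dilations of `μ`
      BlockCMV.IsNaimarkDilation μ (BlockCMV.inclLeft 𝔐 S.H₀) (BlockCMV.cmv μ.schurFun hE) ∧
      BlockCMV.IsMinimalDilation (BlockCMV.inclLeft 𝔐 S.H₀) (BlockCMV.cmv μ.schurFun hE) ∧
      BlockCMV.IsNaimarkDilation μ (BlockCMV.inclLeft 𝔐 S.Ht₀) (BlockCMV.cmvt μ.schurFun hE) ∧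
      BlockCMV.IsMinimalDilation (BlockCMV.inclLeft 𝔐 S.Ht₀) (BlockCMV.cmvt μ.schurFun hE) ∧
      -- they are unitarily equivalent, by a unitary operator that fixes `𝔐`
      ∃ W : WithLp 2 (𝔐 × S.H₀) ≃ₗᵢ[ℂ] WithLp 2 (𝔐 × S.Ht₀),
        (∀ h, W (BlockCMV.cmv μ.schurFun hE h) = BlockCMV.cmvt μ.schurFun hE (W h)) ∧
        ∀ x, W (BlockCMV.inclLeft 𝔐 S.H₀ x) = BlockCMV.inclLeft 𝔐 S.Ht₀ x := by
  have hE := BlockCMV.OperatorMeasure.isSchurClass_schurFun hμ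
  refine ⟨BlockCMV.OperatorMeasure.hasIntegral_fourierCoeff hμ, fun z hz =>
    ⟨BlockCMV.OperatorMeasure.hasIntegral_caratheodory hμ hz,
      BlockCMV.OperatorMeasure.isUnit_caratheodory_add_one hμ hz⟩, hE, ?_⟩
  exact ⟨fun n => ⟨BlockCMV.SchurFunction.isSchurIterate_iterate _ n, fun Θ' hΘ' =>
      hΘ'.eqOn (BlockCMV.SchurFunction.isSchurIterate_iterate _ n)⟩,
    BlockCMV.isNaimarkDilation_cmv hμ hE, BlockCMV.isMinimalDilation_cmv _ hE,
    BlockCMV.isNaimarkDilation_cmvt hμ hE, BlockCMV.isMinimalDilation_cmvt _ hE,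
    (BlockCMV.SchurFunction.mk 𝔐 𝔐 μ.schurFun hE).M₀, BlockCMV.M₀_cmv _ hE,
    BlockCMV.M₀_inclLeft _ hE⟩
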